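/- \textbf{Theorem (Systems of linear equations over finite Abelian groups).} Let $G=\mathbb{Z}_{d_1}\times\cdots\times\mathbb{Z}_{d_m}$ and $H=\mathbb{Z}_{c_1}\times\cdots\times\mathbb{Z}_{c_n}$ be explicitly given products of cyclic groups with all $d_i\ge 2$ and $c_j\ge 2$, where $\mathbb{Z}_d=\{0,\ldots,d-1\}$. Let $b\in G$, and let $A$ be an $m\times n$ integer matrix which defines a group homomorphism from $H$ to $G$; that is, the columns of $A$ are elements of $G$ (so $0\le A_{ij}<d_i$), and the map $H\to G$, $x\mapsto Ax \pmod G$, in which $x$ is read as a column of integers, is a group homomorphism. Consider the system of equations $Ax=b \pmod G$ with unknown $x\in H$. There exist deterministic classical algorithms which, given $m$, $n$, the $d_i$, the $c_j$, $A$ and $b$ (all integers in binary), solve each of the following problems in time $\mathrm{polylog}(|H|,|G|)$, i.e. with a number of bit operations bounded by a fixed polynomial in $\log|H|$ and $\log|G|$: \begin{enumerate} \item Decide whether the system admits a solution. \item Count the number of different solutions of the system. \item Find a general solution of the system: if the system has a solution, this is a tuple $(x_0,x_1,\ldots,x_r)$ of elements of $H$ such that $x_0$ is a solution and $x_1,\ldots,x_r$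 generate $\ker A=\{x\in H : Ax=0 \pmod G\}$, so that the set of solutions is exactly $\{x_0+\sum_{i=1}^r k_i x_i : k_1,\ldots,k_r\in\mathbb{Z}\}$; if it has none, it is the empty tuple. Moreover the length of the tuple is bounded by a fixed polynomial in $\log|H|$. \end{enumerate} Here time is measured on a random access machine over the integers with the logarithmic (bit) cost criterion. -/

import Mathlib

/-! ## Machine model

A random access machine with the logarithmic (bit) cost criterion, programmed by structured
commands.  Cells hold integers; the memory consists of numbered banks, and the bank of every access
is a constant of the program, while the address inside the bank is computed. -/

namespace RAM

/-- The number of bits in the binary expansion of `|z|`. -/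
def size (z : ℤ) : ℕ := Nat.size z.natAbs

/-- Memory contents: bank, then address. -/
abbrev Mem := ℕ → ℕ → ℤ

/-- Arithmetic expressions. -/
inductive Expr
  | const (z : ℤ)
  | load (bank : ℕ) (addr : Expr)
  | add (e₁ e₂ : Expr)
  | sub (e₁ e₂ : Expr)
  | mul (e₁ e₂ : Expr)
  | div (e₁ e₂ : Expr)
  | mod (e₁ e₂ : Expr)
  | lt (e₁ e₂ : Expr)
  | eq (e₁ e₂ : Expr)

/-- The value of an expression.  Division is Euclidean division of integers; comparisons return
`1` or `0`; a negative address is read as address `0`. -/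
def Expr.value (M : Mem) : Expr → ℤ
  | .const z => z
  | .load k a => M k (a.value M).toNat
  | .add e₁ e₂ => e₁.value M + e₂.value M
  | .sub e₁ e₂ => e₁.value M - e₂.value M
  | .mul e₁ e₂ => e₁.value M * e₂.value M
  | .div e₁ e₂ => e₁.value M / e₂.value M
  | .mod e₁ e₂ => e₁.value M % e₂.value M
  | .lt e₁ e₂ => if e₁.value M < e₂.value M then 1 else 0
  | .eq e₁ e₂ => if e₁.value M = e₂.value M then 1 else 0

/-- The bit cost of evaluating an expression: linear in the bit sizes of the operands (and of the
addresses) for memory access, addition, subtraction and comparison, and quadratic for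
multiplication and division with remainder, as in the elementary algorithms. -/
def Expr.cost (M : Mem) : Expr → ℕ
  | .const z => size z + 1
  | .load k a => a.cost M + size (a.value M) + size (M k (a.value M).toNat) + 1
  | .add e₁ e₂ => e₁.cost M + e₂.cost M + (size (e₁.value M) + size (e₂.value M) + 1)
  | .sub e₁ e₂ => e₁.cost M + e₂.cost M + (size (e₁.value M) + size (e₂.value M) + 1)
  | .mul e₁ e₂ => e₁.cost M + e₂.cost M + (size (e₁.value M) + 1) * (size (e₂.value M) + 1)
  | .div e₁ e₂ => e₁.cost M + e₂.cost M + (size (e₁.value M) + 1) * (size (e₂.value M) + 1)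
  | .mod e₁ e₂ => e₁.cost M + e₂.cost M + (size (e₁.value M) + 1) * (size (e₂.value M) + 1)
  | .lt e₁ e₂ => e₁.cost M + e₂.cost M + (size (e₁.value M) + size (e₂.value M) + 1)
  | .eq e₁ e₂ => e₁.cost M + e₂.cost M + (size (e₁.value M) + size (e₂.value M) + 1)

/-- Programs.  A guard counts as true when its value is nonzero. -/
inductive Prog
  | skip
  | store (bank : ℕ) (addr val : Expr)
  | seq (p q : Prog)
  | cond (guard : Expr) (p q : Prog)
  | loop (guard : Expr) (body : Prog)

/-- The memory after writing `z` at address `a` of bank `k`. -/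
def Mem.write (M : Mem) (k a : ℕ) (z : ℤ) : Mem :=
  Function.update M k (Function.update (M k) a z)

/-- `Run p M M' t`: started on memory `M`, the program `p` halts with memory `M'`, and the total
bit cost of the run is `t`. -/
inductive Run : Prog → Mem → Mem → ℕ → Prop
  | skip (M : Mem) : Run .skip M M 1
  | store (M : Mem) (k : ℕ) (a e : Expr) :
      Run (.store k a e) M (M.write k (a.value M).toNat (e.value M))
        (a.cost M + e.cost M + size (a.value M) + size (e.value M) + 1)
  | seq {p q : Prog} {M M' M'' : Mem} {t t' : ℕ} (hp : Run p M M' t) (hq : Run q M' M'' t') :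
      Run (.seq p q) M M'' (t + t')
  | cond_true {g : Expr} {p q : Prog} {M M' : Mem} {t : ℕ} (hg : g.value M ≠ 0)
      (hp : Run p M M' t) : Run (.cond g p q) M M' (g.cost M + t + 1)
  | cond_false {g : Expr} {p q : Prog} {M M' : Mem} {t : ℕ} (hg : g.value M = 0)
      (hq : Run q M M' t) : Run (.cond g p q) M M' (g.cost M + t + 1)
  | loop_true {g : Expr} {p : Prog} {M M' M'' : Mem} {t t' : ℕ} (hg : g.value M ≠ 0)
      (hp : Run p M M' t) (hl : Run (.loop g p) M' M'' t') :
      Run (.loop g p) M M'' (g.cost M + t + t' + 1)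
  | loop_false {g : Expr} {p : Prog} {M : Mem} (hg : g.value M = 0) :
      Run (.loop g p) M M (g.cost M + 1)

/-- The machine is deterministic: the run, its result and its cost are unique. -/
theorem Run.unique {p : Prog} {M M₁ M₂ : Mem} {t₁ t₂ : ℕ} (h₁ : Run p M M₁ t₁)
    (h₂ : Run p M M₂ t₂) : M₁ = M₂ ∧ t₁ = t₂ := by
  induction h₁ generalizing M₂ t₂ with
  | skip M => cases h₂; exact ⟨rfl, rfl⟩
  | store M k a e => cases h₂; exact ⟨rfl, rfl⟩
  | seq hp hq ihp ihq =>
    cases h₂ with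
    | seq hp' hq' =>
      obtain ⟨rfl, rfl⟩ := ihp hp'
      obtain ⟨rfl, rfl⟩ := ihq hq'
      exact ⟨rfl, rfl⟩
  | cond_true hg hp ih =>
    cases h₂ with
    | cond_true _ hp' => obtain ⟨rfl, rfl⟩ := ih hp'; exact ⟨rfl, rfl⟩
    | cond_false hg' _ => exact absurd hg' hg
  | cond_false hg hp ih =>
    cases h₂ with
    | cond_true hg' _ => exact absurd hg hg'
    | cond_false _ hp' => obtain ⟨rfl, rfl⟩ := ih hp'; exact ⟨rfl, rfl⟩
  | loop_true hg hp hl ihp ihl =>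
    cases h₂ with
    | loop_true _ hp' hl' =>
      obtain ⟨rfl, rfl⟩ := ihp hp'
      obtain ⟨rfl, rfl⟩ := ihl hl'
      exact ⟨rfl, rfl⟩
    | loop_false hg' => exact absurd hg' hg
  | loop_false hg =>
    cases h₂ with
    | loop_true hg' _ _ => exact absurd hg hg'
    | loop_false _ => exact ⟨rfl, rfl⟩

/-- The initial memory: the input words occupy the first cells of bank `0`, and every other cell
holds `0`. -/
def inputMem (w : List ℤ) : Mem := fun k a => if k = 0 then w.getD a 0 else 0

/-- The output words are found in the first cells of bank `1`. -/
def HasOutput (M : Mem) (w : List ℤ) : Prop := ∀ (a : ℕ) (ha : a < w.length), M 1 a = w[a]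

end RAM

/-! ## Linear systems over finite Abelian groups -/

/-- For a matrix of integers `A`, the map `x ↦ A x (mod G)` from `H = ∏ ℤ_{c_j}` to
`G = ∏ ℤ_{d_i}`: the entries of `x` are read as the integers `0, …, c_j - 1`. -/
def mulVecMod {m n : ℕ} (d : Fin m → ℕ) (c : Fin n → ℕ) (A : Matrix (Fin m) (Fin n) ℤ)
    (x : ∀ j, ZMod (c j)) : ∀ i, ZMod (d i) :=
  fun i => ((∑ j, A i j * ((x j).val : ℤ) : ℤ) : ZMod (d i))

/-- An instance of the problem: explicitly decomposed groups `G = ∏ ℤ_{d_i}` and `H = ∏ ℤ_{c_j}`,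
a matrix `A` that defines a homomorphism from `H` to `G`, and `b ∈ G`. -/
structure LinSystem where
  m : ℕ
  n : ℕ
  d : Fin m → ℕ
  c : Fin n → ℕ
  two_le_d : ∀ i, 2 ≤ d i
  two_le_c : ∀ j, 2 ≤ c j
  A : Matrix (Fin m) (Fin n) ℤ
  /-- The columns of `A` are elements of `G`. -/
  col_mem : ∀ i j, 0 ≤ A i j ∧ A i j < d i
  /-- `x ↦ A x (mod G)` is a group homomorphism. -/
  map_add : ∀ x y, mulVecMod d c A (x + y) = mulVecMod d c A x + mulVecMod d c A y
  b : ∀ i, ZMod (d i)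

namespace LinSystem

variable (S : LinSystem)

/-- The group `H` of unknowns. -/
abbrev H : Type := ∀ j, ZMod (S.c j)

/-- The group `G` of right-hand sides. -/
abbrev G : Type := ∀ i, ZMod (S.d i)

/-- The solutions `x ∈ H` of `A x = b (mod G)`. -/
def solutions : Set S.H := {x | mulVecMod S.d S.c S.A x = S.b}

/-- The kernel of the homomorphism defined by `A`. -/
def kernel : Set S.H := {x | mulVecMod S.d S.c S.A x = 0}

/-- The input words: `m, n, d_1, …, d_m, c_1, …, c_n`, the entries of `A` row by row, and `b`. -/
def encode : List ℤ :=
  [(S.m : ℤ), (S.n : ℤ)] ++ List.ofFn (fun i => (S.d i : ℤ)) ++ List.ofFn (fun j => (S.c j : ℤ)) ++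
    List.ofFn (fun k : Fin (S.m * S.n) => S.A k.divNat k.modNat) ++
    List.ofFn (fun i => ((S.b i).val : ℤ))

/-- The words encoding a tuple of elements of `H`: its length, then the elements one by one. -/
def encodeTuple (xs : List S.H) : List ℤ :=
  (xs.length : ℤ) :: xs.flatMap fun x => List.ofFn fun j => ((x j).val : ℤ)

/-- A general solution: the empty tuple if there is no solution, and otherwise a tuple
`(x₀, x₁, …, x_r)` where `x₀` is a solution and `x₁, …, x_r` generate the kernel, so that the
solutions are exactly the combinations `x₀ + ∑ kᵢ xᵢ` with integer coefficients. -/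
def IsGeneralSolution : List S.H → Prop
  | [] => S.solutions = ∅
  | x₀ :: xs =>
      x₀ ∈ S.solutions ∧
      (AddSubgroup.closure {x | x ∈ xs} : Set S.H) = S.kernel ∧
      S.solutions = {x | ∃ k : Fin xs.length → ℤ, x = x₀ + ∑ i, k i • xs.get i}

end LinSystem

/-- `SolvableInPolylogTime R`: there is one program that, on every system `S`, halts with an output
`w` such that `R S w`, with a bit cost bounded by a fixed polynomial in `log |H|` and `log |G|`. -/
def SolvableInPolylogTime (R : LinSystem → List ℤ → Prop) : Prop :=
  ∃ (p : RAM.Prog) (C k : ℕ), ∀ S : LinSystem, ∃ (M : RAM.Mem) (t : ℕ) (w : List ℤ),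
    RAM.Run p (RAM.inputMem S.encode) M t ∧
    t ≤ C * (Nat.log 2 (Nat.card S.H) + Nat.log 2 (Nat.card S.G) + 1) ^ k ∧
    RAM.HasOutput M w ∧ R S w

/-!
The equations are taken into account one after the other.  Let `K` be the subgroup of `H` that the
homogeneous versions of the equations so far cut out, given by `n` generators, and let
`φ : H → ℤ_d` be the left-hand side of the next equation.  The pairs `(x, z)` in `H × ℤ` with
`x ∈ K` and `z ≡ φ x (mod d)` form a subgroup, the lifted graph of `φ`; it is generated by the
pivot `(0, d)` and the pairs `(x_l, φ x_l)` for the generators `x_l` of `K`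
(`closure_eq_graphLift`).  Euclidean steps between the pivot and one generator at a time preserve
this subgroup (`closure_insert_range_swap`) and lead to generators `(p, g), (x_1', 0), …, (x_n', 0)`
with `g > 0`.  Then

* the `x_l'` generate the next kernel `K ∩ ker φ`, so the number of generators never grows
  (`closure_range_eq_inf_ker`);
* `φ` maps `K` onto the subgroup generated by `g`, which divides `d`, so the order of the kernel is
  multiplied by `g / d` (`card_mul_pivot_eq`);
* a particular solution `x₀` of the equations so far, with `v ≡ φ x₀ - b`, can be corrected to
  satisfy the new equation exactly when `g` divides `v`, namely to `x₀ - (v / g) p`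
  (`solution_step`).

Vectors are kept reduced modulo the `c_j` and values modulo `d`, so every cell stays bounded by
`|H| * |G|` throughout, and the Euclidean algorithm takes a number of steps linear in the bit size
(`euclidMeasure_lt`).  Since `2 ^ n ≤ |H|` and `2 ^ m ≤ |G|`, the number of commands executed is
polynomial in `log |H| + log |G|`, and so is the cost of each.  The predicate `RAM.Ok` combines
total correctness, the time bound and the bound on the cells, so that one proof along the program
gives all three.
-/

namespace RAM

/-! ### Cost of expressions -/

theorem size_le_size {x y : ℤ} (h : x.natAbs ≤ y.natAbs) : size x ≤ size y := Nat.size_le_size h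

theorem size_add_le (x y : ℤ) : size (x + y) ≤ size x + size y + 1 := by
  unfold size
  rw [Nat.size_le]
  have h₁ := Nat.lt_size_self x.natAbs
  have h₂ := Nat.lt_size_self y.natAbs
  have h₃ : 2 ^ x.natAbs.size ≤ 2 ^ (x.natAbs.size + y.natAbs.size) :=
    Nat.pow_le_pow_right (by norm_num) (by omega)
  have h₄ : 2 ^ y.natAbs.size ≤ 2 ^ (x.natAbs.size + y.natAbs.size) :=
    Nat.pow_le_pow_right (by norm_num) (by omega)
  rw [pow_succ]
  have := Int.natAbs_add_le x y
  omega

theorem size_sub_le (x y : ℤ) : size (x - y) ≤ size x + size y + 1 := by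
  have := size_add_le x (-y)
  simpa [size, sub_eq_add_neg] using this

theorem size_mul_le (x y : ℤ) : size (x * y) ≤ size x + size y := by
  unfold size
  rw [Nat.size_le, Int.natAbs_mul, pow_add]
  exact Nat.mul_lt_mul'' (Nat.lt_size_self _) (Nat.lt_size_self _)

theorem size_ediv_le (x y : ℤ) : size (x / y) ≤ size x :=
  size_le_size (Int.natAbs_ediv_le_natAbs x y)

theorem size_emod_le (x y : ℤ) : size (x % y) ≤ size x + size y := by
  rcases eq_or_ne y 0 with rfl | hy
  · simp
  · refine le_add_left (size_le_size ?_)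
    have := Int.emod_nonneg x hy
    have := Int.emod_lt_abs x hy
    rw [Int.abs_eq_natAbs] at this
    omega

/-- The number of nodes of an expression, a constant being counted with its binary length. -/
def Expr.weight : Expr → ℕ
  | .const z => size z + 1
  | .load _ a => a.weight + 1
  | .add e₁ e₂ | .sub e₁ e₂ | .mul e₁ e₂ | .div e₁ e₂ | .mod e₁ e₂ | .lt e₁ e₂ | .eq e₁ e₂ =>
    e₁.weight + e₂.weight + 1

/-- All cells of the memory are at most `B` in absolute value. -/
def Bdd (B : ℕ) (M : Mem) : Prop := ∀ k a, (M k a).natAbs ≤ B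

/-- The value of an expression has size linear in the size of the cells: this is where the
program-dependent constant of the running time comes from. -/
theorem Expr.size_value_le {B : ℕ} {M : Mem} (hM : Bdd B M) (e : Expr) :
    size (e.value M) ≤ e.weight * (B.size + 1) := by
  have key : ∀ {z w₁ w₂ s₁ s₂ : ℕ}, z ≤ s₁ + s₂ + 1 → s₁ ≤ w₁ * (B.size + 1) →
      s₂ ≤ w₂ * (B.size + 1) → z ≤ (w₁ + w₂ + 1) * (B.size + 1) := by
    intros; nlinarith
  induction e with
  | const z => simp only [value, weight]; nlinarith
  | load k a ih =>
    have : size (M k (a.value M).toNat) ≤ B.size := Nat.size_le_size (hM _ _)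
    simp only [value, weight]; nlinarith
  | add e₁ e₂ h₁ h₂ => exact key (size_add_le _ _) h₁ h₂
  | sub e₁ e₂ h₁ h₂ => exact key (size_sub_le _ _) h₁ h₂
  | mul e₁ e₂ h₁ h₂ => exact key ((size_mul_le _ _).trans (by omega)) h₁ h₂
  | div e₁ e₂ h₁ h₂ => exact key ((size_ediv_le _ (e₂.value M)).trans (by omega)) h₁ h₂
  | mod e₁ e₂ h₁ h₂ => exact key ((size_emod_le _ _).trans (by omega)) h₁ h₂
  | lt e₁ e₂ h₁ h₂ =>
    refine key (s₁ := size (e₁.value M)) (s₂ := size (e₂.value M)) ?_ h₁ h₂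
    simp only [value]; split_ifs <;> simp [size]
  | eq e₁ e₂ h₁ h₂ =>
    refine key (s₁ := size (e₁.value M)) (s₂ := size (e₂.value M)) ?_ h₁ h₂
    simp only [value]; split_ifs <;> simp [size]

theorem Expr.cost_le {B : ℕ} {M : Mem} (hM : Bdd B M) (e : Expr) :
    e.cost M ≤ (e.weight * (B.size + 1)) ^ 2 := by
  have key : ∀ {z w₁ w₂ c₁ c₂ s₁ s₂ : ℕ}, z ≤ c₁ + c₂ + (s₁ + 1) * (s₂ + 1) →
      c₁ ≤ (w₁ * (B.size + 1)) ^ 2 → c₂ ≤ (w₂ * (B.size + 1)) ^ 2 → s₁ ≤ w₁ * (B.size + 1) →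
      s₂ ≤ w₂ * (B.size + 1) → z ≤ ((w₁ + w₂ + 1) * (B.size + 1)) ^ 2 := by
    intro z w₁ w₂ c₁ c₂ s₁ s₂ hz h₁ h₂ k₁ k₂
    have h₃ : (s₁ + 1) * (s₂ + 1) ≤ (w₁ * (B.size + 1) + 1) * (w₂ * (B.size + 1) + 1) := by gcongr
    generalize B.size = s at *
    have h₄ : ((w₁ + w₂ + 1) * (s + 1)) ^ 2 = (w₁ * (s + 1)) ^ 2 + (w₂ * (s + 1)) ^ 2 +
        (w₁ * (s + 1) + 1) * (w₂ * (s + 1) + 1) + (w₁ * w₂ * (s + 1) ^ 2 +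
          (w₁ + w₂) * (s + 1) * (2 * s + 1) + s * (s + 2)) := by ring
    rw [h₄]
    omega
  have hs := fun e => Expr.size_value_le hM e
  induction e with
  | const z => simp only [cost, weight]; nlinarith [Nat.zero_le (size z), Nat.zero_le B.size,
      Nat.le_self_pow two_ne_zero ((size z + 1) * (B.size + 1))]
  | load k a ih =>
    have h₁ : size (M k (a.value M).toNat) ≤ B.size := Nat.size_le_size (hM _ _)
    have h₂ := hs a
    simp only [cost, weight]; nlinarith
  | add e₁ e₂ h₁ h₂ =>
    exact key (by simp only [cost]; ring_nf; omega) h₁ h₂ (hs e₁) (hs e₂)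
  | sub e₁ e₂ h₁ h₂ =>
    exact key (by simp only [cost]; ring_nf; omega) h₁ h₂ (hs e₁) (hs e₂)
  | mul e₁ e₂ h₁ h₂ => exact key le_rfl h₁ h₂ (hs e₁) (hs e₂)
  | div e₁ e₂ h₁ h₂ => exact key le_rfl h₁ h₂ (hs e₁) (hs e₂)
  | mod e₁ e₂ h₁ h₂ => exact key le_rfl h₁ h₂ (hs e₁) (hs e₂)
  | lt e₁ e₂ h₁ h₂ =>
    exact key (by simp only [cost]; ring_nf; omega) h₁ h₂ (hs e₁) (hs e₂)
  | eq e₁ e₂ h₁ h₂ =>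
    exact key (by simp only [cost]; ring_nf; omega) h₁ h₂ (hs e₁) (hs e₂)

/-! ### Total correctness with time bounds -/

theorem Mem.write_bank_ne (M : Mem) {k k' : ℕ} (a : ℕ) (z : ℤ) (h : k' ≠ k) :
    M.write k a z k' = M k' := by
  simp [Mem.write, h]

theorem Mem.write_self (M : Mem) (k a : ℕ) (z : ℤ) : M.write k a z k a = z := by
  simp [Mem.write]

theorem Mem.write_addr_ne (M : Mem) (k : ℕ) {a a' : ℕ} (z : ℤ) (h : a' ≠ a) :
    M.write k a z k a' = M k a' := by
  simp [Mem.write, h]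

theorem Bdd.write {B : ℕ} {M : Mem} (h : Bdd B M) (k a : ℕ) {z : ℤ} (hz : z.natAbs ≤ B) :
    Bdd B (M.write k a z) := by
  intro k' a'
  rcases eq_or_ne k' k with rfl | hk
  · rcases eq_or_ne a' a with rfl | ha
    · rwa [Mem.write_self]
    · rw [Mem.write_addr_ne _ _ _ ha]; exact h _ _
  · rw [Mem.write_bank_ne _ _ _ hk]; exact h _ _

/-- The most that one command can cost, apart from the commands nested in it, when its
expressions have total weight less than `60` and all cells are bounded by `B`.  The number `60` is
chosen large enough for every expression that occurs below. -/
def unitCost (B : ℕ) : ℕ := (60 * (B.size + 1)) ^ 2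

/-- Total correctness: started on `M`, if all cells are bounded by `B`, the program `p` halts after
at most `T` units of cost, its memory stays bounded by `B`, and the final memory satisfies `Q`. -/
def Ok (B : ℕ) (p : Prog) (M : Mem) (T : ℕ) (Q : Mem → Prop) : Prop :=
  Bdd B M → ∃ M' t, Run p M M' t ∧ t ≤ T * unitCost B ∧ Bdd B M' ∧ Q M'

variable {B : ℕ} {p q : Prog} {M : Mem} {T T' : ℕ} {Q Q' : Mem → Prop}

theorem Ok.mono (h : Ok B p M T Q) (hT : T ≤ T') (hQ : ∀ M', Q M' → Q' M') :
    Ok B p M T' Q' := fun hM => by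
  obtain ⟨M', t, h₁, h₂, h₃, h₄⟩ := h hM
  exact ⟨M', t, h₁, h₂.trans (Nat.mul_le_mul_right _ hT), h₃, hQ _ h₄⟩

theorem Ok.of_bdd (h : Bdd B M → Ok B p M T Q) : Ok B p M T Q := fun hM => h hM hM

theorem Ok.seq (h : Ok B p M T (fun M' => Ok B q M' T' Q)) : Ok B (.seq p q) M (T + T') Q :=
  fun hM => by
    obtain ⟨M', t, h₁, h₂, h₃, h₄⟩ := h hM
    obtain ⟨M'', t', h₁', h₂', h₃', h₄'⟩ := h₄ h₃
    exact ⟨M'', t + t', .seq h₁ h₁', by rw [add_mul]; omega, h₃', h₄'⟩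

theorem Ok.store {k : ℕ} {a e : Expr} (hw : a.weight + e.weight < 60)
    (he : Bdd B M → (e.value M).natAbs ≤ B)
    (hQ : Q (M.write k (a.value M).toNat (e.value M))) : Ok B (.store k a e) M 1 Q := fun hM => by
  refine ⟨_, _, .store M k a e, ?_, hM.write _ _ (he hM), hQ⟩
  have h₁ := a.cost_le hM
  have h₂ := e.cost_le hM
  have h₃ := a.size_value_le hM
  have h₄ := e.size_value_le hM
  have h₅ : ((a.weight + e.weight + 1) * (B.size + 1)) ^ 2 ≤ unitCost B := by
    unfold unitCost; gcongr; omega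
  nlinarith [Nat.zero_le (a.weight * e.weight * (B.size + 1) ^ 2),
    Nat.zero_le (a.weight * (B.size + 1) * B.size),
    Nat.zero_le (e.weight * (B.size + 1) * B.size)]

theorem Ok.store_seq {k : ℕ} {a e : Expr} (hw : a.weight + e.weight < 60)
    (he : Bdd B M → (e.value M).natAbs ≤ B)
    (hQ : Ok B q (M.write k (a.value M).toNat (e.value M)) T Q) :
    Ok B (.seq (.store k a e) q) M (T + 1) Q := by
  rw [add_comm]
  exact Ok.seq (Ok.store hw he hQ)

/-- The index of the invariant `I` bounds the number of iterations that are left. -/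
theorem Ok.loop {g : Expr} (I : ℕ → Mem → Prop) (hw : g.weight < 60)
    (hstep : ∀ k M, I k M → g.value M ≠ 0 → Ok B p M T (fun M' => ∃ k' < k, I k' M'))
    (hQ : ∀ k M, I k M → g.value M = 0 → Q M) {k : ℕ} (hI : I k M) :
    Ok B (.loop g p) M (k * (T + 1) + 1) Q := by
  have hguard : ∀ M, Bdd B M → g.cost M + 1 ≤ unitCost B := fun M hM => by
    have h₁ := g.cost_le hM
    have h₅ : ((g.weight + 1) * (B.size + 1)) ^ 2 ≤ unitCost B := by
      unfold unitCost; gcongr; omega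
    nlinarith [Nat.zero_le (g.weight * (B.size + 1) ^ 2),
      Nat.one_le_pow 2 (B.size + 1) (Nat.succ_pos _)]
  induction k using Nat.strong_induction_on generalizing M with
  | _ k ih =>
    intro hM
    have hc := hguard M hM
    by_cases hg : g.value M = 0
    · refine ⟨M, _, .loop_false hg, ?_, hM, hQ k M hI hg⟩
      nlinarith [Nat.zero_le (k * (T + 1) * unitCost B)]
    · obtain ⟨M', t, h₁, h₂, h₃, k', hk', hI'⟩ := hstep k M hI hg hM
      obtain ⟨M'', t', h₁', h₂', h₃', h₄'⟩ := ih k' hk' hI' h₃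
      refine ⟨M'', _, .loop_true hg h₁ h₁', ?_, h₃', h₄'⟩
      have : ((k' + 1) * (T + 1) + 1) * unitCost B ≤ (k * (T + 1) + 1) * unitCost B := by
        gcongr; omega
      nlinarith

/-- The scalar variable kept in cell `0` of bank `k`. -/
abbrev Expr.var (k : ℕ) : Expr := .load k (.const 0)

/-- Assignment to the scalar variable kept in cell `0` of bank `k`. -/
abbrev Prog.assign (k : ℕ) (e : Expr) : Prog := .store k (.const 0) e

/-- `body` is run with the variable of bank `j` equal to `0, 1, …, bound - 1`. -/
def Prog.for (j : ℕ) (bound : Expr) (body : Prog) : Prog :=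
  .seq (.assign j (.const 0))
    (.loop (.lt (.var j) bound) (.seq body (.assign j (.add (.var j) (.const 1)))))

/-- The invariant `I i` holds after `i` iterations.  Besides the body, an iteration costs one unit
for the guard and one for the increment of the index. -/
theorem Ok.for {j : ℕ} {bound : Expr} (I : ℕ → Mem → Prop) (N : ℕ) (hw : bound.weight < 50)
    (hN : N ≤ B) (hbound : ∀ i M, I i M → bound.value M = N) (h0 : I 0 (M.write j 0 0))
    (hstep : ∀ i < N, ∀ M, I i M → M j 0 = i →
      Ok B p M T (fun M' => M' j 0 = i ∧ I (i + 1) (M'.write j 0 (i + 1))))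
    (hQ : ∀ M, I N M → Q M) : Ok B (.for j bound p) M (N * (T + 2) + 2) Q := by
  refine Ok.store_seq (T := N * (T + 2) + 1) (by simp [Expr.weight, size]) (by simp [Expr.value]) ?_
  refine Ok.loop (T := T + 1) (k := N)
    (fun k M => ∃ i ≤ N, k + i = N ∧ M j 0 = i ∧ I i M) ?_ ?_ ?_ ?_
  · simp [Expr.weight, size]; omega
  · rintro k M ⟨i, hi, hk, hj, hI⟩ hg
    have hlt : i < N := by
      simpa [Expr.value, hbound i M hI, hj] using hg
    refine Ok.seq ((hstep i hlt M hI hj).mono le_rfl ?_)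
    rintro M' ⟨hj', hI'⟩
    refine Ok.store (by simp [Expr.weight, size]) (fun _ => ?_) ?_
    · simp [Expr.value, hj']; omega
    · refine ⟨k - 1, by omega, i + 1, by omega, by omega, ?_⟩
      simpa [Expr.value, hj', Mem.write_self] using hI'
  · rintro k M ⟨i, hi, hk, hj, hI⟩ hg
    have : N ≤ i := by
      simpa [Expr.value, hbound i M hI, hj] using hg
    obtain rfl : i = N := le_antisymm hi this
    exact hQ _ hI
  · exact ⟨0, Nat.zero_le _, by simp, by simp [Expr.value, Mem.write_self],
      by simpa [Expr.value] using h0⟩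

end RAM

namespace LinSystem

open RAM

/-! ### The program -/

/-! Bank `0` holds the input and is never written.  Bank `1` holds rows of length `n`: coordinate
`j` of row `k` is at address `1 + k * n + j`.  Row `0` is a particular solution and the rows `1, …, n` are
generators of the kernel, so that cell `0` only has to receive the length to complete the output.
Bank `2` holds the pivot.  The other banks hold one variable each: `3`, `4` and `5` the indices of
the equation, of the generator and of the coordinate, `6` the value of the current row, `7` the
value of the pivot, `8` a quotient, `9` an intermediate result, `10` the solvability flag, `11` the
order of the kernel, and `12` the number of the current row. -/

/-- The number `m` of equations. -/
def mE : Expr := .load 0 (.const 0)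

/-- The number `n` of unknowns. -/
def nE : Expr := .load 0 (.const 1)

/-- The modulus `d i` of the current equation. -/
def dE : Expr := .load 0 (.add (.const 2) (.var 3))

/-- The modulus `c j` of the current unknown. -/
def cE : Expr := .load 0 (.add (.add (.const 2) mE) (.var 5))

/-- The coefficient `A i j`. -/
def aE : Expr :=
  .load 0 (.add (.add (.add (.add (.const 2) mE) nE) (.mul (.var 3) nE)) (.var 5))

/-- The right-hand side `b i`. -/
def bE : Expr := .load 0 (.add (.add (.add (.add (.const 2) mE) nE) (.mul mE nE)) (.var 3))

/-- The address of coordinate `j` of the current row, in bank `1`. -/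
def rowAddr : Expr := .add (.add (.const 1) (.mul (.var 12) nE)) (.var 5)

/-- Coordinate `j` of the current row. -/
def rowE : Expr := .load 1 rowAddr

/-- Coordinate `j` of the pivot. -/
def pivE : Expr := .load 2 (.var 5)

/-- Adds to variable `6` the value of equation `i` on the current row, modulo `d i`. -/
def innerProd : Prog := .for 5 nE (.assign 6 (.mod (.add (.var 6) (.mul aE rowE)) dE))

/-- Replaces the pair (pivot, current row) by (current row, pivot - `q` * current row), with
`q` in variable `8`. -/
def swapRows : Prog :=
  .for 5 nE (.seq (.assign 9 (.mod (.sub pivE (.mul (.var 8) rowE)) cE))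
    (.seq (.store 2 (.var 5) rowE) (.store 1 rowAddr (.var 9))))

/-- One step of the Euclidean algorithm on the pivot, with its value in variable `7`, and the
current row, with its value in variable `6`. -/
def euclidStep : Prog :=
  .seq (.assign 8 (.div (.var 7) (.var 6))) (.seq swapRows
    (.seq (.assign 9 (.mod (.var 7) (.var 6)))
      (.seq (.assign 7 (.var 6)) (.assign 6 (.var 9)))))

/-- Subtracts `q` times the pivot from the current row, with `q` in variable `8`. -/
def subPivot : Prog :=
  .for 5 nE (.store 1 rowAddr (.mod (.sub rowE (.mul (.var 8) pivE)) cE))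

/-- Evaluates equation `i` on generator `k` and clears its value against the pivot. -/
def clearRow : Prog :=
  .seq (.assign 12 (.add (.var 4) (.const 1))) (.seq (.assign 6 (.const 0))
    (.seq innerProd (.loop (.var 6) euclidStep)))

/-- Sets the pivot to the zero vector, with value `d i`. -/
def initPivot : Prog := .seq (.assign 7 dE) (.for 5 nE (.store 2 (.var 5) (.const 0)))

/-- Corrects the particular solution, which is row `0`, by a multiple of the pivot; variable `10`
drops to `0` when equation `i` has no solution. -/
def correctSolution : Prog :=
  .seq (.assign 12 (.const 0)) (.seq (.assign 6 (.mod (.sub (.const 0) bE) dE)) (.seq innerProd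
    (.seq (.assign 8 (.div (.var 6) (.var 7))) (.seq subPivot
      (.assign 10 (.mul (.var 10) (.eq (.mod (.var 6) (.var 7)) (.const 0))))))))

/-- Takes equation `i` into account. -/
def equation : Prog :=
  .seq initPivot (.seq (.for 4 nE clearRow) (.seq correctSolution
    (.assign 11 (.div (.mul (.var 11) (.var 7)) dE))))

/-- Starts with the particular solution `0`, the unit vectors as generators, and `|H|` as the
number of solutions. -/
def initRows : Prog :=
  .seq (.assign 10 (.const 1)) (.seq (.assign 11 (.const 1))
    (.for 5 nE (.seq
      (.store 1 (.add (.add (.const 1) (.mul (.add (.var 5) (.const 1)) nE)) (.var 5)) (.const 1))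
      (.assign 11 (.mul (.var 11) cE)))))

/-- Solves the system: at the end variable `10` tells whether there is a solution, variable `11`
is the order of the kernel, and bank `1` holds the general solution from address `1` on. -/
def solve : Prog := .seq initRows (.for 3 mE equation)

/-! ### Specifications of the parts of the program -/

/-- The memories `M` and `M'` agree on all banks outside the list `s`. -/
def AgreeOff (s : List ℕ) (M M' : Mem) : Prop := ∀ b ∉ s, M' b = M b

theorem AgreeOff.refl (s : List ℕ) (M : Mem) : AgreeOff s M M := fun _ _ => rfl

theorem AgreeOff.trans {s s' t : List ℕ} {M M' M'' : Mem} (h : AgreeOff s M M')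
    (h' : AgreeOff s' M' M'') (hs : s ⊆ t) (hs' : s' ⊆ t) : AgreeOff t M M'' := fun b hb =>
  (h' b fun h => hb (hs' h)).trans (h b fun h => hb (hs h))

theorem AgreeOff.write {s : List ℕ} {M M' : Mem} (h : AgreeOff s M M') {k : ℕ} (hk : k ∈ s)
    (a : ℕ) (z : ℤ) : AgreeOff s M (M'.write k a z) := fun b hb => by
  rw [Mem.write_bank_ne _ _ _ (by rintro rfl; exact hb hk), h b hb]

section

variable {B m n : ℕ} {M : Mem} {i j k : ℕ}

/-- The memory starts with the numbers `m` and `n`, the moduli `c j` are positive, and these and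
`n` are at most `B`. -/
structure HasInput (B m n : ℕ) (M : Mem) : Prop where
  zero : M 0 0 = m
  one : M 0 1 = n
  c_pos : ∀ j < n, 0 < M 0 (2 + m + j)
  c_le : ∀ j < n, M 0 (2 + m + j) ≤ B
  n_le : n ≤ B

theorem HasInput.congr {M' : Mem} (h : HasInput B m n M) (h0 : M' 0 = M 0) : HasInput B m n M' := by
  cases h
  constructor <;> simpa only [h0]

theorem value_mE (h : HasInput B m n M) : mE.value M = m := by simp [mE, Expr.value, h.zero]

theorem value_nE (h : HasInput B m n M) : nE.value M = n := by simp [nE, Expr.value, h.one]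

theorem value_dE (hi : M 3 0 = i) : dE.value M = M 0 (2 + i) := by
  simp only [dE, Expr.value, Int.toNat_zero, hi]; norm_cast

theorem value_cE (h : HasInput B m n M) (hj : M 5 0 = j) : cE.value M = M 0 (2 + m + j) := by
  simp only [cE, Expr.value, Int.toNat_zero, hj, value_mE h]; norm_cast

theorem value_aE (h : HasInput B m n M) (hi : M 3 0 = i) (hj : M 5 0 = j) :
    aE.value M = M 0 (2 + m + n + i * n + j) := by
  simp only [aE, Expr.value, Int.toNat_zero, hi, hj, value_mE h, value_nE h]; norm_cast

theorem value_bE (h : HasInput B m n M) (hi : M 3 0 = i) :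
    bE.value M = M 0 (2 + m + n + m * n + i) := by
  simp only [bE, Expr.value, Int.toNat_zero, hi, value_mE h, value_nE h]; norm_cast

theorem value_rowAddr (h : HasInput B m n M) (hk : M 12 0 = k) (hj : M 5 0 = j) :
    (rowAddr.value M).toNat = 1 + k * n + j := by
  simp only [rowAddr, Expr.value, Int.toNat_zero, hk, hj, value_nE h]; norm_cast

theorem value_rowE (h : HasInput B m n M) (hk : M 12 0 = k) (hj : M 5 0 = j) :
    rowE.value M = M 1 (1 + k * n + j) := by
  simp only [rowE, Expr.value, value_rowAddr h hk hj]

theorem value_pivE (hj : M 5 0 = j) : pivE.value M = M 2 j := by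
  simp [pivE, Expr.value, hj]

theorem natAbs_emod_le {x y : ℤ} (hy : 0 < y) (hB : y ≤ B) : (x % y).natAbs ≤ B := by
  have := Int.emod_nonneg x hy.ne'
  have := Int.emod_lt_of_pos x hy
  omega

theorem innerProd_ok (h : HasInput B m n M) (hi : M 3 0 = i) (hk : M 12 0 = k)
    (hd : 0 < M 0 (2 + i)) (hdB : M 0 (2 + i) ≤ B) (hv : 0 ≤ M 6 0) (hv' : M 6 0 < M 0 (2 + i)) :
    Ok B innerProd M (n * 3 + 2) (fun M' => AgreeOff [5, 6] M M' ∧ 0 ≤ M' 6 0 ∧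
      M' 6 0 < M 0 (2 + i) ∧ M' 6 0 ≡ M 6 0 + ∑ j ∈ Finset.range n,
        M 0 (2 + m + n + i * n + j) * M 1 (1 + k * n + j) [ZMOD M 0 (2 + i)]) := by
  refine Ok.for (fun l M' => AgreeOff [5, 6] M M' ∧ 0 ≤ M' 6 0 ∧
      M' 6 0 < M 0 (2 + i) ∧ M' 6 0 ≡ M 6 0 + ∑ j ∈ Finset.range l,
        M 0 (2 + m + n + i * n + j) * M 1 (1 + k * n + j) [ZMOD M 0 (2 + i)]) n
      (by decide) h.n_le ?_ ?_ ?_ ?_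
  · rintro l M' ⟨hf, -⟩
    exact value_nE (h.congr (hf 0 (by decide)))
  · refine ⟨(AgreeOff.refl _ _).write (by decide) _ _, ?_⟩
    rw [Mem.write_bank_ne _ _ _ (by decide)]
    exact ⟨hv, hv', by simp⟩
  · rintro l hl M' ⟨hf, h1, h2, h3⟩ hj
    have h' := h.congr (hf 0 (by decide))
    have hi' : M' 3 0 = i := by rw [hf 3 (by decide), hi]
    have hk' : M' 12 0 = k := by rw [hf 12 (by decide), hk]
    have hval : (Expr.mod (.add (.var 6) (.mul aE rowE)) dE).value M' =
        (M' 6 0 + M 0 (2 + m + n + i * n + l) * M 1 (1 + k * n + l)) % M 0 (2 + i) := by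
      simp only [Expr.value, Int.toNat_zero, value_aE h' hi' hj, value_rowE h' hk' hj,
        value_dE hi', hf 0 (by decide), hf 1 (by decide)]
    refine Ok.store (by decide) (fun _ => ?_) ?_
    · rw [hval]
      exact natAbs_emod_le hd hdB
    · rw [hval]
      refine ⟨by rwa [Mem.write_bank_ne _ _ _ (by decide)],
        (hf.write (by decide) _ _).write (by decide) _ _, ?_⟩
      rw [Mem.write_bank_ne _ _ _ (by decide), Expr.value, Int.toNat_zero, Mem.write_self]
      refine ⟨Int.emod_nonneg _ hd.ne', Int.emod_lt_of_pos _ hd, ?_⟩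
      rw [Finset.sum_range_succ, ← add_assoc]
      exact (Int.mod_modEq _ _).trans (h3.add_right _)
  · rintro M' h
    exact h

/-- The loop invariant has to record that the coordinates not yet visited are unchanged, because
the pivot and the row are overwritten in place. -/
theorem swapRows_ok (h : HasInput B m n M) (hk : M 12 0 = k) :
    Ok B swapRows M (n * 5 + 2) (fun M' => AgreeOff [1, 2, 5, 9] M M' ∧
      (∀ j < n, M' 2 j = M 1 (1 + k * n + j)) ∧
      (∀ j < n, M' 1 (1 + k * n + j) =
        (M 2 j - M 8 0 * M 1 (1 + k * n + j)) % M 0 (2 + m + j)) ∧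
      ∀ a, a < 1 + k * n ∨ 1 + k * n + n ≤ a → M' 1 a = M 1 a) := by
  refine Ok.for (fun l M' => AgreeOff [1, 2, 5, 9] M M' ∧
      (∀ j < l, M' 2 j = M 1 (1 + k * n + j)) ∧ (∀ j, l ≤ j → M' 2 j = M 2 j) ∧
      (∀ j < l, M' 1 (1 + k * n + j) =
        (M 2 j - M 8 0 * M 1 (1 + k * n + j)) % M 0 (2 + m + j)) ∧
      ∀ a, a < 1 + k * n ∨ 1 + k * n + l ≤ a → M' 1 a = M 1 a) n
      (by decide) h.n_le ?_ ?_ ?_ ?_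
  · rintro l M' ⟨hf, -⟩
    exact value_nE (h.congr (hf 0 (by decide)))
  · refine ⟨(AgreeOff.refl _ _).write (by decide) _ _, ?_⟩
    simp [Mem.write_bank_ne]
  · rintro l hl M' ⟨hf, h1, h2, h3, h4⟩ hj
    have h' := h.congr (hf 0 (by decide))
    have hk' : M' 12 0 = k := by rw [hf 12 (by decide), hk]
    have hval : (Expr.mod (.sub pivE (.mul (.var 8) rowE)) cE).value M' =
        (M 2 l - M 8 0 * M 1 (1 + k * n + l)) % M 0 (2 + m + l) := by
      simp only [Expr.value, Int.toNat_zero, value_pivE hj, value_rowE h' hk' hj,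
        value_cE h' hj, hf 0 (by decide), hf 8 (by decide), h2 l le_rfl, h4 _ (Or.inr le_rfl)]
    refine Ok.store_seq (T := 2) (by decide) (fun _ => ?_) ?_
    · rw [hval]
      exact natAbs_emod_le (h.c_pos l hl) (h.c_le l hl)
    rw [hval]
    set z := (M 2 l - M 8 0 * M 1 (1 + k * n + l)) % M 0 (2 + m + l) with hz
    set M₁ := M'.write 9 ((Expr.const 0).value M').toNat z with hM₁
    have hf₁ : AgreeOff [9] M' M₁ := (AgreeOff.refl _ _).write (by decide) _ _
    have hj₁ : M₁ 5 0 = l := by rw [hf₁ 5 (by decide), hj]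
    have hk₁ : M₁ 12 0 = k := by rw [hf₁ 12 (by decide), hk']
    have h₁ := h'.congr (hf₁ 0 (by decide))
    have hrow : rowE.value M₁ = M 1 (1 + k * n + l) := by
      rw [value_rowE h₁ hk₁ hj₁, hf₁ 1 (by decide), h4 _ (Or.inr le_rfl)]
    refine Ok.store_seq (T := 1) (by decide) (fun hb => ?_) ?_
    · rw [value_rowE h₁ hk₁ hj₁]
      exact hb _ _
    rw [hrow]
    have hadr : ((Expr.var 5).value M₁).toNat = l := by simp [Expr.value, hj₁]
    rw [hadr]
    set M₂ := M₁.write 2 l (M 1 (1 + k * n + l)) with hM₂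
    have hf₂ : AgreeOff [2] M₁ M₂ := (AgreeOff.refl _ _).write (by decide) _ _
    have hj₂ : M₂ 5 0 = l := by rw [hf₂ 5 (by decide), hj₁]
    have hk₂ : M₂ 12 0 = k := by rw [hf₂ 12 (by decide), hk₁]
    have h₂ := h₁.congr (hf₂ 0 (by decide))
    refine Ok.store (by decide) (fun hb => hb _ _) ?_
    have hz₂ : (Expr.var 9).value M₂ = z := by
      simp [Expr.value, hM₂, hM₁, Mem.write_self, Mem.write_bank_ne]
    rw [value_rowAddr h₂ hk₂ hj₂, hz₂]
    have e1 : M₂ 1 = M' 1 := (hf₂ 1 (by decide)).trans (hf₁ 1 (by decide))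
    refine ⟨by rwa [Mem.write_bank_ne _ _ _ (by decide)], ?_, ?_, ?_, ?_, ?_⟩
    · exact (((hf.trans hf₁ (t := [1, 2, 5, 9]) (by simp) (by simp)).trans hf₂
        (t := [1, 2, 5, 9]) (by simp) (by simp)).write (by decide) _ _).write (by decide) _ _
    · intro j hj
      rw [Mem.write_bank_ne _ _ _ (by decide), Mem.write_bank_ne _ _ _ (by decide)]
      rcases eq_or_ne j l with rfl | hjl
      · rw [hM₂, Mem.write_self]
      · rw [hM₂, Mem.write_addr_ne _ _ _ hjl, hf₁ 2 (by decide), h1 j (by omega)]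
    · intro j hj
      rw [Mem.write_bank_ne _ _ _ (by decide), Mem.write_bank_ne _ _ _ (by decide), hM₂,
        Mem.write_addr_ne _ _ _ (by omega), hf₁ 2 (by decide), h2 j (by omega)]
    · intro j hj
      rw [Mem.write_bank_ne _ _ _ (by decide)]
      rcases eq_or_ne j l with rfl | hjl
      · rw [Mem.write_self]
      · rw [Mem.write_addr_ne _ _ _ (by omega), e1, h3 j (by omega)]
    · intro a ha
      rw [Mem.write_bank_ne _ _ _ (by decide), Mem.write_addr_ne _ _ _ (by omega), e1,
        h4 a (by omega)]
  · rintro M' ⟨hf, h1, -, h3, h4⟩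
    exact ⟨hf, h1, h3, h4⟩

theorem euclidStep_ok (h : HasInput B m n M) (hk : M 12 0 = k) :
    Ok B euclidStep M (n * 5 + 6) (fun M' => AgreeOff [1, 2, 5, 6, 7, 8, 9] M M' ∧
      M' 7 0 = M 6 0 ∧ M' 6 0 = M 7 0 % M 6 0 ∧
      (∀ j < n, M' 2 j = M 1 (1 + k * n + j)) ∧
      (∀ j < n, M' 1 (1 + k * n + j) =
        (M 2 j - M 7 0 / M 6 0 * M 1 (1 + k * n + j)) % M 0 (2 + m + j)) ∧
      ∀ a, a < 1 + k * n ∨ 1 + k * n + n ≤ a → M' 1 a = M 1 a) := by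
  refine Ok.store_seq (T := n * 5 + 5) (by decide) (fun hb => ?_) ?_
  · exact (Int.natAbs_ediv_le_natAbs _ _).trans (hb _ _)
  have hval : (Expr.div (.var 7) (.var 6)).value M = M 7 0 / M 6 0 := by simp [Expr.value]
  rw [hval]
  set M₁ := M.write 8 ((Expr.const 0).value M).toNat (M 7 0 / M 6 0) with hM₁
  have hf₁ : AgreeOff [8] M M₁ := (AgreeOff.refl _ _).write (by decide) _ _
  have e8 : M₁ 8 0 = M 7 0 / M 6 0 := Mem.write_self _ _ _ _
  have h₁ := h.congr (hf₁ 0 (by decide))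
  have hk₁ : M₁ 12 0 = k := by rw [hf₁ 12 (by decide), hk]
  refine Ok.mono (Ok.seq (T' := 3) ((swapRows_ok h₁ hk₁).mono le_rfl ?_)) (by omega) fun _ h => h
  rintro M₂ ⟨hf₂, h1, h2, h3⟩
  rw [e8, hf₁ 0 (by decide), hf₁ 1 (by decide), hf₁ 2 (by decide)] at h2
  rw [hf₁ 1 (by decide)] at h1 h3
  have e7 : M₂ 7 0 = M 7 0 := by rw [hf₂ 7 (by decide), hf₁ 7 (by decide)]
  have e6 : M₂ 6 0 = M 6 0 := by rw [hf₂ 6 (by decide), hf₁ 6 (by decide)]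
  refine Ok.store_seq (T := 2) (by decide) (fun hb => ?_) ?_
  · simp only [Expr.value, Int.toNat_zero, e7, e6]
    rcases lt_trichotomy (M 6 0) 0 with h | h | h
    · have := Int.emod_nonneg (M 7 0) h.ne
      have := Int.emod_lt_abs (M 7 0) h.ne
      rw [Int.abs_eq_natAbs] at this
      have := hb 6 0
      rw [e6] at this
      omega
    -- Here the remainder modulo `0` is the dividend itself.
    · rw [h, Int.emod_zero, ← e7]; exact hb _ _
    · have := hb 6 0
      rw [e6] at this
      exact natAbs_emod_le h (by omega)
  refine Ok.store_seq (T := 1) (by decide) (fun hb => hb _ _) ?_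
  refine Ok.store (by decide) (fun hb => hb _ _) ?_
  simp only [Expr.value, Int.toNat_zero, Mem.write_self]
  refine ⟨?_, ?_, ?_, ?_, ?_, ?_⟩
  · exact (((hf₁.trans hf₂ (t := [1, 2, 5, 6, 7, 8, 9]) (by simp) (by simp)).write
      (by decide) _ _).write (by decide) _ _).write (by decide) _ _
  all_goals simp only [Mem.write_bank_ne, Mem.write_self, e6, e7, ne_eq, Nat.reduceEqDiff,
    not_false_eq_true, OfNat.one_ne_ofNat]
  exacts [h1, h2, h3]

theorem subPivot_ok (h : HasInput B m n M) (hk : M 12 0 = k) :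
    Ok B subPivot M (n * 3 + 2) (fun M' => AgreeOff [1, 5] M M' ∧
      (∀ j < n, M' 1 (1 + k * n + j) =
        (M 1 (1 + k * n + j) - M 8 0 * M 2 j) % M 0 (2 + m + j)) ∧
      ∀ a, a < 1 + k * n ∨ 1 + k * n + n ≤ a → M' 1 a = M 1 a) := by
  refine Ok.for (fun l M' => AgreeOff [1, 5] M M' ∧
      (∀ j < l, M' 1 (1 + k * n + j) =
        (M 1 (1 + k * n + j) - M 8 0 * M 2 j) % M 0 (2 + m + j)) ∧
      ∀ a, a < 1 + k * n ∨ 1 + k * n + l ≤ a → M' 1 a = M 1 a) n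
      (by decide) h.n_le ?_ ?_ ?_ ?_
  · rintro l M' ⟨hf, -⟩
    exact value_nE (h.congr (hf 0 (by decide)))
  · refine ⟨(AgreeOff.refl _ _).write (by decide) _ _, ?_⟩
    simp [Mem.write_bank_ne]
  · rintro l hl M' ⟨hf, h3, h4⟩ hj
    have h' := h.congr (hf 0 (by decide))
    have hk' : M' 12 0 = k := by rw [hf 12 (by decide), hk]
    have hval : (Expr.mod (.sub rowE (.mul (.var 8) pivE)) cE).value M' =
        (M 1 (1 + k * n + l) - M 8 0 * M 2 l) % M 0 (2 + m + l) := by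
      simp only [Expr.value, Int.toNat_zero, value_pivE hj, value_rowE h' hk' hj,
        value_cE h' hj, hf 0 (by decide), hf 8 (by decide), hf 2 (by decide),
        h4 _ (Or.inr le_rfl)]
    refine Ok.store (by decide) (fun _ => ?_) ?_
    · rw [hval]
      exact natAbs_emod_le (h.c_pos l hl) (h.c_le l hl)
    rw [hval, value_rowAddr h' hk' hj]
    refine ⟨by rwa [Mem.write_bank_ne _ _ _ (by decide)],
      (hf.write (by decide) _ _).write (by decide) _ _, ?_, ?_⟩
    · intro j hj
      rw [Mem.write_bank_ne _ _ _ (by decide)]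
      rcases eq_or_ne j l with rfl | hjl
      · rw [Mem.write_self]
      · rw [Mem.write_addr_ne _ _ _ (by omega), h3 j (by omega)]
    · intro a ha
      rw [Mem.write_bank_ne _ _ _ (by decide), Mem.write_addr_ne _ _ _ (by omega), h4 a (by omega)]
  · exact fun M' h => h

theorem initPivot_ok (h : HasInput B m n M) (hi : M 3 0 = i) :
    Ok B initPivot M (n * 3 + 3) (fun M' => AgreeOff [2, 5, 7] M M' ∧
      M' 7 0 = M 0 (2 + i) ∧ ∀ j < n, M' 2 j = 0) := by
  refine Ok.store_seq (T := n * 3 + 2) (by decide) (fun hb => hb _ _) ?_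
  rw [value_dE hi]
  refine Ok.for (fun l M' => AgreeOff [2, 5, 7] M M' ∧
      M' 7 0 = M 0 (2 + i) ∧ ∀ j < l, M' 2 j = 0) n (by decide) h.n_le ?_ ?_ ?_ ?_
  · rintro l M' ⟨hf, -⟩
    exact value_nE (h.congr (hf 0 (by decide)))
  · refine ⟨((AgreeOff.refl _ _).write (by decide) _ _).write (by decide) _ _, ?_⟩
    simp [Mem.write_bank_ne, Mem.write_self, Expr.value]
  · rintro l hl M' ⟨hf, h1, h2⟩ hj
    refine Ok.store (by decide) (fun _ => by simp [Expr.value]) ?_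
    refine ⟨by rwa [Mem.write_bank_ne _ _ _ (by decide)],
      (hf.write (by decide) _ _).write (by decide) _ _, ?_, ?_⟩
    · simpa [Mem.write_bank_ne]
    · intro j hj'
      simp only [Expr.value, Int.toNat_zero, hj, Int.toNat_natCast]
      rw [Mem.write_bank_ne _ _ _ (by decide)]
      rcases eq_or_ne j l with rfl | hjl
      · rw [Mem.write_self]
      · rw [Mem.write_addr_ne _ _ _ hjl, h2 j (by omega)]
  · exact fun M' h => h

theorem initRows_ok (h : HasInput B m n M) (hB : 1 ≤ B) (h1 : M 1 = 0)
    (hprod : ∀ l ≤ n, ∏ j ∈ Finset.range l, M 0 (2 + m + j) ≤ B) :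
    Ok B initRows M (n * 4 + 4) (fun M' => AgreeOff [1, 5, 10, 11] M M' ∧ M' 10 0 = 1 ∧
      M' 11 0 = ∏ j ∈ Finset.range n, M 0 (2 + m + j) ∧
      (∀ j < n, M' 1 j.succ = 0) ∧
      ∀ k < n, ∀ j < n, M' 1 (1 + (k + 1) * n + j) = if j = k then 1 else 0) := by
  refine Ok.store_seq (T := n * 4 + 3) (by decide) (fun _ => by simpa [Expr.value]) ?_
  refine Ok.store_seq (T := n * 4 + 2) (by decide) (fun _ => by simpa [Expr.value]) ?_
  simp only [Expr.value, Int.toNat_zero]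
  refine Ok.for (fun l M' => AgreeOff [1, 5, 10, 11] M M' ∧ M' 10 0 = 1 ∧
      M' 11 0 = ∏ j ∈ Finset.range l, M 0 (2 + m + j) ∧
      (∀ a, (∀ k < l, a ≠ 1 + (k + 1) * n + k) → M' 1 a = 0) ∧
      ∀ k < l, M' 1 (1 + (k + 1) * n + k) = 1) n (by decide) h.n_le ?_ ?_ ?_ ?_
  · rintro l M' ⟨hf, -⟩
    exact value_nE (h.congr (hf 0 (by decide)))
  · refine ⟨(((AgreeOff.refl _ _).write (by decide) _ _).write (by decide) _ _).write
      (by decide) _ _, ?_⟩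
    simp [Mem.write_bank_ne, Mem.write_self, h1]
  · rintro l hl M' ⟨hf, h10, h11, hzero, hone⟩ hj
    have h' := h.congr (hf 0 (by decide))
    have hadr : (Expr.value M' (.add (.add (.const 1) (.mul (.add (.var 5) (.const 1)) nE))
        (.var 5))).toNat = 1 + (l + 1) * n + l := by
      simp only [Expr.value, Int.toNat_zero, hj, value_nE h']; norm_cast
    refine Ok.store_seq (T := 1) (by decide) (fun _ => by simpa [Expr.value]) ?_
    rw [hadr]
    simp only [Expr.value]
    set M₁ := M'.write 1 (1 + (l + 1) * n + l) 1 with hM₁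
    have hf₁ : AgreeOff [1] M' M₁ := (AgreeOff.refl _ _).write (by decide) _ _
    have hj₁ : M₁ 5 0 = l := by rw [hf₁ 5 (by decide), hj]
    have h₁ := h'.congr (hf₁ 0 (by decide))
    have hval : (Expr.mul (.var 11) cE).value M₁ =
        ∏ j ∈ Finset.range (l + 1), M 0 (2 + m + j) := by
      simp only [Expr.value, Int.toNat_zero, value_cE h₁ hj₁, hf₁ 11 (by decide),
        hf₁ 0 (by decide), hf 0 (by decide), h11, Finset.prod_range_succ]
    refine Ok.store (by decide) (fun _ => ?_) ?_
    · rw [hval]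
      have := hprod (l + 1) hl
      have : 0 ≤ ∏ j ∈ Finset.range (l + 1), M 0 (2 + m + j) :=
        Finset.prod_nonneg fun j hj => (h.c_pos j (by simp at hj; omega)).le
      omega
    rw [hval]
    refine ⟨by rwa [Mem.write_bank_ne _ _ _ (by decide)], ?_, ?_, ?_, ?_, ?_⟩
    · exact ((hf.trans hf₁ (t := [1, 5, 10, 11]) (by simp) (by simp)).write (by decide) _ _).write
        (by decide) _ _
    · simpa [hM₁, Mem.write_bank_ne]
    · simp [Mem.write_bank_ne, Mem.write_self, Expr.value]
    · intro a ha
      rw [Mem.write_bank_ne _ _ _ (by decide), Mem.write_bank_ne _ _ _ (by decide), hM₁,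
        Mem.write_addr_ne _ _ _ (ha l (by omega))]
      exact hzero a fun k hk => ha k (by omega)
    · intro k hk
      rw [Mem.write_bank_ne _ _ _ (by decide), Mem.write_bank_ne _ _ _ (by decide), hM₁]
      rcases eq_or_ne k l with rfl | hkl
      · rw [Mem.write_self]
      · rw [Mem.write_addr_ne, hone k (by omega)]
        have : k < l := by omega
        nlinarith
  · rintro M' ⟨hf, h10, h11, hzero, hone⟩
    -- A cell is the diagonal cell of a generator only for `j = k`, because `j < n`.
    refine ⟨hf, h10, h11, fun j hj => hzero _ fun k hk => ?_, fun k hk j hj => ?_⟩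
    · nlinarith
    · split_ifs with hjk
      · subst hjk; exact hone j hk
      · refine hzero _ fun k' hk' e => hjk ?_
        have h₁ : (k + 1) * n + j = (k' + 1) * n + k' := by omega
        have h₂ : k = k' := by
          rcases lt_trichotomy k k' with h | h | h
          · nlinarith
          · exact h
          · nlinarith
        subst h₂
        omega

end

end LinSystem

/-! ### Generators of the graph of a homomorphism to a cyclic group -/

section Graph

variable {V : Type*} [AddCommGroup V] {d n : ℕ}

/-- The integral lifts of the graph of `φ` on the subgroup `K`. -/
def graphLift (K : AddSubgroup V) (φ : V →+ ZMod d) : AddSubgroup (V × ℤ) where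
  carrier := {w | w.1 ∈ K ∧ (w.2 : ZMod d) = φ w.1}
  add_mem' := by
    rintro a b ⟨ha, ha'⟩ ⟨hb, hb'⟩
    exact ⟨K.add_mem ha hb, by simp [ha', hb']⟩
  zero_mem' := ⟨K.zero_mem, by simp⟩
  neg_mem' := by
    rintro a ⟨ha, ha'⟩
    exact ⟨K.neg_mem ha, by simp [ha']⟩

/-- A step of the Euclidean algorithm on two generators does not change the subgroup. -/
theorem closure_insert_range_swap {W : Type*} [AddCommGroup W] (a : W) (f : Fin n → W) (l : Fin n)
    (q : ℤ) :
    AddSubgroup.closure (insert (f l) (Set.range (Function.update f l (a - q • f l)))) =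
      AddSubgroup.closure (insert a (Set.range f)) := by
  apply le_antisymm <;> rw [AddSubgroup.closure_le, Set.insert_subset_iff, Set.range_subset_iff]
  · have hf : ∀ j, f j ∈ AddSubgroup.closure (insert a (Set.range f)) := fun j =>
      AddSubgroup.subset_closure (Or.inr ⟨j, rfl⟩)
    refine ⟨hf l, fun j => ?_⟩
    rcases eq_or_ne j l with rfl | hj
    · rw [Function.update_self]
      exact sub_mem (AddSubgroup.subset_closure (Or.inl rfl)) (zsmul_mem (hf j) q)
    · rw [Function.update_of_ne hj]
      exact hf j
  · set L := AddSubgroup.closure (insert (f l) (Set.range (Function.update f l (a - q • f l))))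
    have hl : f l ∈ L := AddSubgroup.subset_closure (Or.inl rfl)
    have hu : ∀ j, Function.update f l (a - q • f l) j ∈ L := fun j =>
      AddSubgroup.subset_closure (Or.inr ⟨j, rfl⟩)
    refine ⟨?_, fun j => ?_⟩
    · have := hu l
      rw [Function.update_self] at this
      simpa using add_mem this (zsmul_mem hl q)
    · rcases eq_or_ne j l with rfl | hj
      · exact hl
      · simpa [hj] using hu j

/-- Lifts of the values on generators, together with the modulus, generate the graph. -/
theorem closure_eq_graphLift [NeZero d] (x : Fin n → V) (φ : V →+ ZMod d) :
    AddSubgroup.closure (insert ((0 : V), (d : ℤ))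
      (Set.range fun l => (x l, ((φ (x l)).val : ℤ)))) =
      graphLift (AddSubgroup.closure (Set.range x)) φ := by
  set L := AddSubgroup.closure (insert ((0 : V), (d : ℤ))
    (Set.range fun l => (x l, ((φ (x l)).val : ℤ)))) with hL
  have hle : L ≤ graphLift (AddSubgroup.closure (Set.range x)) φ := by
    rw [hL, AddSubgroup.closure_le, Set.insert_subset_iff, Set.range_subset_iff]
    exact ⟨⟨zero_mem _, by simp⟩,
      fun l => ⟨AddSubgroup.subset_closure (Set.mem_range_self l), by simp⟩⟩
  refine le_antisymm hle ?_
  · have hex : AddSubgroup.closure (Set.range x) ≤ L.map (AddMonoidHom.fst V ℤ) := by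
      rw [AddSubgroup.closure_le, Set.range_subset_iff]
      exact fun l => ⟨_, AddSubgroup.subset_closure (Or.inr ⟨l, rfl⟩), rfl⟩
    rintro ⟨y, z⟩ ⟨hy, hz⟩
    obtain ⟨⟨y', z'⟩, hL', rfl⟩ := hex hy
    have hz' := (hle hL').2
    simp only [AddMonoidHom.coe_fst] at hz hz' ⊢
    obtain ⟨k, hk⟩ : (d : ℤ) ∣ z - z' := by
      rw [← ZMod.intCast_zmod_eq_zero_iff_dvd]
      simp [hz, hz']
    have h0 : ((0 : V), (d : ℤ)) ∈ L := AddSubgroup.subset_closure (Or.inl rfl)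
    have : (y', z) = (y', z') + k • ((0 : V), (d : ℤ)) := by
      ext <;> simp
      linarith
    rw [this]
    exact add_mem hL' (zsmul_mem h0 k)

variable {K : AddSubgroup V} {φ : V →+ ZMod d} {p : V} {g : ℤ} {x : Fin n → V}

/-- Once all generators but the pivot have value `0`, every element of the graph is a multiple of
the pivot plus a combination of these generators. -/
theorem exists_of_mem_graphLift
    (h : AddSubgroup.closure (insert (p, g) (Set.range fun l => (x l, (0 : ℤ)))) = graphLift K φ)
    {w : V × ℤ} (hw : w ∈ graphLift K φ) :
    ∃ k : ℤ, w.1 - k • p ∈ AddSubgroup.closure (Set.range x) ∧ w.2 = k * g := by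
  rw [← h] at hw
  induction hw using AddSubgroup.closure_induction with
  | mem w hw =>
    rcases hw with rfl | ⟨l, rfl⟩
    · exact ⟨1, by simp, by simp⟩
    · exact ⟨0, by simpa using AddSubgroup.subset_closure (Set.mem_range_self l),
        by simp⟩
  | zero => exact ⟨0, by simp, by simp⟩
  | add a b _ _ ha hb =>
    obtain ⟨k, h₁, h₂⟩ := ha
    obtain ⟨k', h₁', h₂'⟩ := hb
    refine ⟨k + k', ?_, ?_⟩
    · have := add_mem h₁ h₁'
      rwa [sub_add_sub_comm, ← add_smul] at this
    · rw [Prod.snd_add, h₂, h₂', add_mul]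
  | neg a _ ha =>
    obtain ⟨k, h₁, h₂⟩ := ha
    refine ⟨-k, ?_, ?_⟩
    · have := neg_mem h₁
      rwa [neg_sub', ← neg_smul] at this
    · rw [Prod.snd_neg, h₂, neg_mul]

theorem closure_range_eq_inf_ker
    (h : AddSubgroup.closure (insert (p, g) (Set.range fun l => (x l, (0 : ℤ)))) = graphLift K φ)
    (hg : g ≠ 0) : AddSubgroup.closure (Set.range x) = K ⊓ φ.ker := by
  apply le_antisymm
  · rw [AddSubgroup.closure_le, Set.range_subset_iff]
    intro l
    have : (x l, (0 : ℤ)) ∈ graphLift K φ := h ▸ AddSubgroup.subset_closure (Or.inr ⟨l, rfl⟩)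
    exact ⟨this.1, by simpa using this.2.symm⟩
  · rintro y ⟨hy, hy'⟩
    obtain ⟨k, h₁, h₂⟩ := exists_of_mem_graphLift h (w := (y, 0))
      ⟨hy, by simpa using (AddMonoidHom.mem_ker.mp hy').symm⟩
    obtain rfl : k = 0 := by simpa [hg] using h₂
    simpa using h₁

theorem pivot_mem
    (h : AddSubgroup.closure (insert (p, g) (Set.range fun l => (x l, (0 : ℤ)))) = graphLift K φ) :
    p ∈ K ∧ φ p = g := by
  have : (p, g) ∈ graphLift K φ := h ▸ AddSubgroup.subset_closure (Or.inl rfl)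
  exact ⟨this.1, this.2.symm⟩

theorem pivot_dvd
    (h : AddSubgroup.closure (insert (p, g) (Set.range fun l => (x l, (0 : ℤ)))) = graphLift K φ)
    {y : V} (hy : y ∈ K) {z : ℤ} (hz : φ y = z) : g ∣ z := by
  obtain ⟨k, -, h₂⟩ := exists_of_mem_graphLift h (w := (y, z)) ⟨hy, hz.symm⟩
  exact ⟨k, by rw [mul_comm]; exact h₂⟩

theorem pivot_dvd_modulus
    (h : AddSubgroup.closure (insert (p, g) (Set.range fun l => (x l, (0 : ℤ)))) = graphLift K φ) :
    g ∣ d :=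
  pivot_dvd h K.zero_mem (by simp)

/-- The image of `K` under `φ` is generated by the value `g` of the pivot, so it has order
`d / g`. -/
theorem card_mul_pivot_eq [NeZero d]
    (h : AddSubgroup.closure (insert (p, g) (Set.range fun l => (x l, (0 : ℤ)))) = graphLift K φ)
    (hg : 0 < g) :
    (Nat.card K : ℤ) * g = Nat.card (K ⊓ φ.ker : AddSubgroup V) * d := by
  lift g to ℕ using hg.le
  obtain ⟨hp, hpg⟩ := pivot_mem h
  have hgd : g ∣ d := by exact_mod_cast pivot_dvd_modulus h
  have hmap : K.map φ = AddSubgroup.zmultiples ((g : ZMod d)) := by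
    apply le_antisymm
    · rintro _ ⟨y, hy, rfl⟩
      obtain ⟨k, hk⟩ := pivot_dvd h hy (z := (φ y).val) (by simp)
      refine ⟨k, ?_⟩
      have := congrArg (fun t : ℤ => (t : ZMod d)) hk
      simp only [Int.cast_natCast, ZMod.natCast_zmod_val, Int.cast_mul] at this
      simp [this, mul_comm]
    · rw [AddSubgroup.zmultiples_le]
      exact ⟨p, hp, by simpa using hpg⟩
  have hcard : Nat.card (K.map φ) = d / g := by
    rw [hmap, Nat.card_zmultiples, ZMod.addOrderOf_coe _ (NeZero.ne d),
      Nat.gcd_eq_right hgd]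
  have hrel : Nat.card K = Nat.card (K ⊓ φ.ker : AddSubgroup V) * Nat.card (K.map φ) := by
    rw [← AddSubgroup.relIndex_ker, ← AddSubgroup.inf_relIndex_left,
      ← AddSubgroup.relIndex_bot_left, ← AddSubgroup.relIndex_bot_left,
      AddSubgroup.relIndex_mul_relIndex _ _ _ bot_le inf_le_left]
  rw [hrel, hcard]
  have : d / g * g = d := Nat.div_mul_cancel hgd
  norm_cast
  rw [mul_assoc, this]

end Graph

namespace LinSystem

variable (S : LinSystem)

/-! ### The homomorphisms defined by the rows of the matrix -/

instance (i : Fin S.m) : NeZero (S.d i) := ⟨by have := S.two_le_d i; omega⟩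

instance (j : Fin S.n) : NeZero (S.c j) := ⟨by have := S.two_le_c j; omega⟩

/-- The left-hand side of equation `i` as a homomorphism. -/
def rowHom (i : Fin S.m) : S.H →+ ZMod (S.d i) :=
  AddMonoidHom.mk' (fun x => mulVecMod S.d S.c S.A x i) fun x y => by
    rw [S.map_add, Pi.add_apply]

/-- The reduction of an integer vector to an element of `H`. -/
def vec (y : ℕ → ℤ) : S.H := fun j => (y j : ZMod (S.c j))

theorem dvd_entry_mul (i : Fin S.m) (j : Fin S.n) : (S.d i : ℤ) ∣ S.A i j * S.c j := by
  have : Fact (1 < S.c j) := ⟨S.two_le_c j⟩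
  have h1 : S.rowHom i (Pi.single j 1) = (S.A i j : ZMod (S.d i)) := by
    change ((∑ j', S.A i j' * (((Pi.single j 1 : S.H) j').val : ℤ) : ℤ) : ZMod (S.d i)) = _
    rw [Finset.sum_eq_single j]
    · simp [ZMod.val_one]
    · intro j' _ hj'
      simp [hj']
    · simp
  have h2 : S.c j • (Pi.single j 1 : S.H) = 0 := by
    rw [← Pi.single_smul]
    simp
  have h3 : S.c j • S.rowHom i (Pi.single j 1) = 0 := by rw [← map_nsmul, h2, map_zero]
  rw [← ZMod.intCast_zmod_eq_zero_iff_dvd]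
  rw [h1] at h3
  simpa [mul_comm] using h3

/-- The matrix acts on reduced vectors as it does on integer vectors: here the hypothesis that it
defines a homomorphism enters. -/
theorem rowHom_vec (i : Fin S.m) (y : ℕ → ℤ) :
    S.rowHom i (S.vec y) = ((∑ j : Fin S.n, S.A i j * y j : ℤ) : ZMod (S.d i)) := by
  change ((∑ j, S.A i j * ((S.vec y j).val : ℤ) : ℤ) : ZMod (S.d i)) = _
  rw [ZMod.intCast_eq_intCast_iff_dvd_sub, ← Finset.sum_sub_distrib]
  refine Finset.dvd_sum fun j _ => ?_
  have h : S.A i j * y j - S.A i j * ((S.vec y j).val : ℤ) = S.A i j * S.c j * (y j / S.c j) := by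
    rw [vec, ZMod.val_intCast, Int.emod_def]
    ring
  rw [h]
  exact (S.dvd_entry_mul i j).mul_right _

/-- The subgroup of solutions of the first `i` homogeneous equations. -/
def kerUpTo (i : ℕ) : AddSubgroup S.H := ⨅ i' : {i' : Fin S.m // i' < i}, (S.rowHom i').ker

/-- The set of solutions of the first `i` equations. -/
def solUpTo (i : ℕ) : Set S.H := {x | ∀ i' : Fin S.m, i' < i → S.rowHom i' x = S.b i'}

variable {S}

theorem mem_kerUpTo {i : ℕ} {x : S.H} :
    x ∈ S.kerUpTo i ↔ ∀ i' : Fin S.m, i' < i → S.rowHom i' x = 0 := by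
  simp [kerUpTo, AddSubgroup.mem_iInf, AddMonoidHom.mem_ker]

theorem kerUpTo_zero : S.kerUpTo 0 = ⊤ := by
  ext x; simp [mem_kerUpTo]

theorem kerUpTo_succ (i : Fin S.m) : S.kerUpTo (i + 1) = S.kerUpTo i ⊓ (S.rowHom i).ker := by
  ext x
  simp only [mem_kerUpTo, AddSubgroup.mem_inf, AddMonoidHom.mem_ker, Nat.lt_succ_iff_lt_or_eq]
  refine ⟨fun h => ⟨fun i' hi => h i' (.inl hi), h i (.inr rfl)⟩, ?_⟩
  rintro ⟨h, h'⟩ i' (hi | hi)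
  · exact h i' hi
  · obtain rfl := Fin.ext hi
    exact h'

theorem mem_solUpTo_succ {i : Fin S.m} {x : S.H} :
    x ∈ S.solUpTo (i + 1) ↔ x ∈ S.solUpTo i ∧ S.rowHom i x = S.b i := by
  simp only [solUpTo, Set.mem_ofPred_eq, Nat.lt_succ_iff_lt_or_eq]
  refine ⟨fun h => ⟨fun i' hi => h i' (.inl hi), h i (.inr rfl)⟩, ?_⟩
  rintro ⟨h, h'⟩ i' (hi | hi)
  · exact h i' hi
  · obtain rfl := Fin.ext hi
    exact h'

theorem coe_kerUpTo_eq : (S.kerUpTo S.m : Set S.H) = S.kernel := by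
  ext x
  simp only [SetLike.mem_coe, mem_kerUpTo, kernel, Set.mem_ofPred_eq, funext_iff]
  exact ⟨fun h i => h i i.2, fun h i _ => h i⟩

theorem solUpTo_eq : S.solUpTo S.m = S.solutions := by
  ext x
  simp only [solUpTo, solutions, Set.mem_ofPred_eq, funext_iff]
  exact ⟨fun h i => h i i.2, fun h i _ => h i⟩

theorem solUpTo_zero : S.solUpTo 0 = Set.univ := by
  ext x; simp [solUpTo]

theorem sub_mem_kerUpTo {i : ℕ} {x y : S.H} (hx : x ∈ S.solUpTo i) (hy : y ∈ S.solUpTo i) :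
    x - y ∈ S.kerUpTo i := by
  rw [mem_kerUpTo]
  intro i' hi
  rw [map_sub, hx i' hi, hy i' hi, sub_self]

theorem sub_mem_solUpTo {i : ℕ} {x y : S.H} (hx : x ∈ S.solUpTo i) (hy : y ∈ S.kerUpTo i) :
    x - y ∈ S.solUpTo i := by
  intro i' hi
  rw [map_sub, hx i' hi, mem_kerUpTo.mp hy i' hi, sub_zero]

/-- The solutions form a coset of the kernel. -/
theorem mem_solutions_iff {x₀ x : S.H} (h : x₀ ∈ S.solutions) :
    x ∈ S.solutions ↔ x - x₀ ∈ S.kerUpTo S.m := by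
  rw [← solUpTo_eq] at *
  refine ⟨fun hx => sub_mem_kerUpTo hx h, fun hx => ?_⟩
  simpa using sub_mem_solUpTo h (neg_mem hx)

theorem card_solutions {x₀ : S.H} (h : x₀ ∈ S.solutions) :
    Nat.card S.solutions = Nat.card (S.kerUpTo S.m) :=
  Nat.card_congr ((Equiv.subRight x₀).subtypeEquiv fun _ => mem_solutions_iff h)

theorem isGeneralSolution_cons {x₀ : S.H} (h : x₀ ∈ S.solutions) {r : ℕ} {x : Fin r → S.H}
    (hx : AddSubgroup.closure (Set.range x) = S.kerUpTo S.m) :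
    S.IsGeneralSolution (x₀ :: List.ofFn x) := by
  have hset : {y | y ∈ List.ofFn x} = Set.range x := by
    ext y; simp [List.mem_ofFn]
  refine ⟨h, by rw [hset, hx, coe_kerUpTo_eq], ?_⟩
  have hrange : Set.range (List.ofFn x).get = Set.range x := by
    rw [Set.range_list_get, hset]
  ext y
  rw [mem_solutions_iff h, ← hx, ← hrange, Set.mem_ofPred_eq,
    AddSubgroup.mem_closure_range_iff_of_fintype]
  simp only [sub_eq_iff_eq_add']

end LinSystem

namespace LinSystem

open RAM

variable (S : LinSystem)

/-! ### Correctness of the elimination -/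

/-- Bank `0` holds the encoding of the system `S`, and `B` bounds its moduli. -/
structure IsInput (B : ℕ) (M : Mem) : Prop extends HasInput B S.m S.n M where
  d_eq : ∀ i : Fin S.m, M 0 (2 + i) = S.d i
  d_le : ∀ i, S.d i ≤ B
  c_eq : ∀ j : Fin S.n, M 0 (2 + S.m + j) = S.c j
  A_eq : ∀ (i : Fin S.m) (j : Fin S.n), M 0 (2 + S.m + S.n + i * S.n + j) = S.A i j
  b_eq : ∀ i : Fin S.m, M 0 (2 + S.m + S.n + S.m * S.n + i) = (S.b i).val

/-- Row `k` of bank `1` as an element of `H`. -/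
def rowVec (M : Mem) (k : ℕ) : S.H := S.vec fun j => M 1 (1 + k * S.n + j)

/-- The pivot as an element of `H`. -/
def pivVec (M : Mem) : S.H := S.vec (M 2)

/-- Coordinate `j` of each row lies between `0` and `c j - 1`. -/
def Reduced (M : Mem) : Prop :=
  ∀ k ≤ S.n, ∀ j < S.n, 0 ≤ M 1 (1 + k * S.n + j) ∧ M 1 (1 + k * S.n + j) < M 0 (2 + S.m + j)

/-- The subgroup of `H × ℤ` generated by the pivot, with its value, and the generators, with
values `w`. -/
def lattice (M : Mem) (w : Fin S.n → ℤ) : AddSubgroup (S.H × ℤ) :=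
  AddSubgroup.closure (insert (S.pivVec M, M 7 0)
    (Set.range fun l : Fin S.n => (S.rowVec M (l + 1), w l)))

variable {S} {B : ℕ} {M M' : Mem}

theorem IsInput.congr (h : S.IsInput B M) (h0 : M' 0 = M 0) : S.IsInput B M' where
  toHasInput := h.toHasInput.congr h0
  d_eq := by simpa only [h0] using h.d_eq
  d_le := h.d_le
  c_eq := by simpa only [h0] using h.c_eq
  A_eq := by simpa only [h0] using h.A_eq
  b_eq := by simpa only [h0] using h.b_eq

theorem Reduced.congr (h : S.Reduced M) (h0 : M' 0 = M 0) (h1 : M' 1 = M 1) : S.Reduced M' := by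
  simpa only [Reduced, h0, h1] using h

theorem vec_emod (h : S.IsInput B M) {y y' : ℕ → ℤ}
    (hy : ∀ j < S.n, y j = y' j % M 0 (2 + S.m + j)) : S.vec y = S.vec y' := by
  ext j
  simp [vec, hy j j.2, h.c_eq j]

theorem rowVec_congr {k : ℕ} (h : ∀ j < S.n, M' 1 (1 + k * S.n + j) = M 1 (1 + k * S.n + j)) :
    S.rowVec M' k = S.rowVec M k := by
  ext j
  simp [rowVec, vec, h j j.2]

theorem rowVec_congr_bank (h : M' 1 = M 1) (k : ℕ) : S.rowVec M' k = S.rowVec M k :=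
  rowVec_congr fun j _ => by rw [h]

/-- Distinct rows occupy distinct cells. -/
theorem addr_lt_or_le {n k l j : ℕ} (hkl : l ≠ k) (hj : j < n) :
    1 + l * n + j < 1 + k * n ∨ 1 + k * n + n ≤ 1 + l * n + j := by
  rcases lt_or_gt_of_ne hkl with h | h
  · left; nlinarith
  · right; nlinarith

theorem rowVec_of_frame {k l : ℕ} (hkl : l ≠ k)
    (h : ∀ a, a < 1 + k * S.n ∨ 1 + k * S.n + S.n ≤ a → M' 1 a = M 1 a) :
    S.rowVec M' l = S.rowVec M l :=
  rowVec_congr fun _ hj => h _ (addr_lt_or_le hkl hj)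

theorem Reduced.of_frame {k : ℕ} (hM : S.IsInput B M) (hr : S.Reduced M) (h0 : M' 0 = M 0)
    {y : ℕ → ℤ} (hk : ∀ j < S.n, M' 1 (1 + k * S.n + j) = y j % M 0 (2 + S.m + j))
    (h : ∀ a, a < 1 + k * S.n ∨ 1 + k * S.n + S.n ≤ a → M' 1 a = M 1 a) : S.Reduced M' := by
  intro l hl j hj
  rw [h0]
  rcases eq_or_ne l k with rfl | hlk
  · rw [hk j hj]
    exact ⟨Int.emod_nonneg _ (hM.c_pos j hj).ne', Int.emod_lt_of_pos _ (hM.c_pos j hj)⟩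
  · rw [h _ (addr_lt_or_le hlk hj)]
    exact hr l hl j hj

/-- The sizes of the two arguments of the Euclidean algorithm, plus one if the first step only
exchanges them: a bound for the number of steps. -/
def euclidMeasure (g v : ℤ) : ℕ := size g + size v + if g < v then 1 else 0

theorem euclidMeasure_lt {g v : ℤ} (hg : 0 < g) (hv : 0 < v) :
    euclidMeasure v (g % v) < euclidMeasure g v := by
  have h₁ := Int.emod_nonneg g hv.ne'
  have h₂ := Int.emod_lt_of_pos g hv
  unfold euclidMeasure
  rw [if_neg (by omega : ¬ v < g % v)]
  split_ifs with h
  · rw [Int.emod_eq_of_lt hg.le h]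
    omega
  · -- Since `v + g % v ≤ g`, the remainder is less than half of `g`.
    have h₃ : v + g % v ≤ g := by
      have h₄ := Int.emod_add_mul_ediv g v
      have h₅ : 1 ≤ g / v := by rw [Int.le_ediv_iff_mul_le hv]; omega
      nlinarith
    have h₆ : size (g % v) < size g := by
      unfold size
      rw [Nat.lt_size]
      rcases Nat.eq_zero_or_pos (g % v).natAbs.size with h0 | hpos
      · rw [h0]; omega
      · have h₇ : 2 ^ ((g % v).natAbs.size - 1) ≤ (g % v).natAbs :=
          Nat.lt_size.mp (by omega)
        obtain ⟨s, hs⟩ : ∃ s, (g % v).natAbs.size = s + 1 := ⟨_, (Nat.sub_add_cancel hpos).symm⟩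
        rw [hs, Nat.add_sub_cancel] at h₇
        rw [hs, pow_succ]
        omega
    omega

theorem euclidMeasure_le {g v : ℤ} (hg : g.natAbs ≤ B) (hv : v.natAbs ≤ B) :
    euclidMeasure g v ≤ 2 * B.size + 1 := by
  have h₁ : size g ≤ B.size := Nat.size_le_size hg
  have h₂ : size v ≤ B.size := Nat.size_le_size hv
  unfold euclidMeasure
  split_ifs <;> omega

/-- A Euclidean step on the rows and their values leaves the lattice unchanged. -/
theorem lattice_swap {w : Fin S.n → ℤ} {k : Fin S.n} {q : ℤ} (hp : S.pivVec M' = S.rowVec M (k + 1))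
    (hg : M' 7 0 = w k) (hrow : S.rowVec M' (k + 1) = S.pivVec M - q • S.rowVec M (k + 1))
    (hne : ∀ l, l ≠ (k : ℕ) + 1 → S.rowVec M' l = S.rowVec M l) :
    S.lattice M' (Function.update w k (M 7 0 - q * w k)) = S.lattice M w := by
  unfold lattice
  rw [← closure_insert_range_swap _ (fun l : Fin S.n => (S.rowVec M (l + 1), w l)) k q]
  congr 2
  · rw [hp, hg]
  · congr 1
    ext1 l
    rcases eq_or_ne l k with rfl | hl
    · simp [hrow]
    · have : (l : ℕ) + 1 ≠ k + 1 := fun h => hl (Fin.ext (by omega))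
      simp [hl, hne _ this]

theorem euclidLoop_ok (hM : S.IsInput B M) (hr : S.Reduced M) {k : Fin S.n}
    (hk : M 12 0 = ((k + 1 : ℕ) : ℤ)) (h7 : 0 < M 7 0) (h6 : 0 ≤ M 6 0) (w : Fin S.n → ℤ) :
    Ok B (.loop (.var 6) euclidStep) M ((2 * B.size + 1) * (S.n * 5 + 7) + 1) (fun M' =>
      AgreeOff [1, 2, 5, 6, 7, 8, 9] M M' ∧ S.Reduced M' ∧ 0 < M' 7 0 ∧
      S.lattice M' (Function.update w k 0) = S.lattice M (Function.update w k (M 6 0)) ∧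
      ∀ l, l ≠ (k : ℕ) + 1 → S.rowVec M' l = S.rowVec M l) := by
  refine Ok.of_bdd fun hb => Ok.mono (T := euclidMeasure (M 7 0) (M 6 0) * (S.n * 5 + 7) + 1) ?_
    (by gcongr; exact euclidMeasure_le (hb _ _) (hb _ _)) fun _ h => h
  refine Ok.loop (fun e M' => e = euclidMeasure (M' 7 0) (M' 6 0) ∧
      AgreeOff [1, 2, 5, 6, 7, 8, 9] M M' ∧ S.Reduced M' ∧ 0 < M' 7 0 ∧ 0 ≤ M' 6 0 ∧
      S.lattice M' (Function.update w k (M' 6 0)) = S.lattice M (Function.update w k (M 6 0)) ∧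
      ∀ l, l ≠ (k : ℕ) + 1 → S.rowVec M' l = S.rowVec M l) (by decide) ?_ ?_
    ⟨rfl, AgreeOff.refl _ _, hr, h7, h6, rfl, fun _ _ => rfl⟩
  · rintro e M' ⟨rfl, hf, hr', h7', h6', hL, hrow⟩ hg
    have h6'' : 0 < M' 6 0 := lt_of_le_of_ne h6' (Ne.symm hg)
    have hM' := hM.congr (hf 0 (by decide))
    have hk' : M' 12 0 = ((k + 1 : ℕ) : ℤ) := by rw [hf 12 (by decide), hk]
    refine (euclidStep_ok hM'.toHasInput hk').mono le_rfl ?_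
    rintro M'' ⟨hf', e7, e6, hp, hq, hfr⟩
    have hne : ∀ l, l ≠ (k : ℕ) + 1 → S.rowVec M'' l = S.rowVec M' l :=
      fun l hl => rowVec_of_frame hl hfr
    refine ⟨_, ?_, rfl, hf.trans hf' (by simp) (by simp),
      Reduced.of_frame hM' hr' (hf' 0 (by decide)) hq hfr, by rwa [e7], ?_, ?_, ?_⟩
    · rw [e7, e6]
      exact euclidMeasure_lt h7' h6''
    · rw [e6]
      exact Int.emod_nonneg _ hg
    · rw [← hL, ← lattice_swap (M' := M'') (q := M' 7 0 / M' 6 0) (k := k) _ _ _ hne]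
      · congr 1
        rw [e6, Function.update_self, Function.update_idem, Int.emod_def, mul_comm]
      · ext j
        simp [pivVec, rowVec, vec, hp j j.2]
      · rw [Function.update_self, e7]
      · rw [rowVec, vec_emod hM' hq]
        ext j
        simp [pivVec, rowVec, vec]
    · intro l hl
      rw [hne l hl, hrow l hl]
  · rintro e M' ⟨rfl, hf, hr', h7', h6', hL, hrow⟩ hg
    have hg' : M' 6 0 = 0 := hg
    exact ⟨hf, hr', h7', by rw [← hL, hg'], hrow⟩

/-- What the inner product computes: the value of equation `i` on row `k`, added to the initial
value of variable `6`. -/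
theorem innerProd_rowHom_ok (hM : S.IsInput B M) (i : Fin S.m) (hi : M 3 0 = i) {k : ℕ}
    (hk : M 12 0 = k) (hv : 0 ≤ M 6 0) (hv' : M 6 0 < S.d i) :
    Ok B innerProd M (S.n * 3 + 2) (fun M' => AgreeOff [5, 6] M M' ∧ 0 ≤ M' 6 0 ∧
      M' 6 0 < S.d i ∧
      (M' 6 0 : ZMod (S.d i)) = (M 6 0 : ZMod (S.d i)) + S.rowHom i (S.rowVec M k)) := by
  have hd := hM.d_eq i
  have h2 := S.two_le_d i
  have h3 := hM.d_le i
  refine (innerProd_ok hM.toHasInput hi hk (by omega) (by omega) hv (by omega)).mono le_rfl ?_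
  rintro M' ⟨hf, h1, h2, h3⟩
  refine ⟨hf, h1, by omega, ?_⟩
  rw [rowVec, rowHom_vec, ← Int.cast_add, ZMod.intCast_eq_intCast_iff, ← hd,
    Finset.sum_congr rfl fun j _ => by rw [← hM.A_eq i j],
    Fin.sum_univ_eq_sum_range (fun j => M 0 (2 + S.m + S.n + i * S.n + j) *
      M 1 (1 + k * S.n + j)) S.n]
  exact h3

/-- A bound for the time of `clearRow`, in units, when the cells have at most `s` bits. -/
def rowTime (n s : ℕ) : ℕ := (n * 3 + 2 + ((2 * s + 1) * (n * 5 + 7) + 1)) + 1 + 1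

theorem clearRow_ok (hM : S.IsInput B M) (hr : S.Reduced M) (i : Fin S.m) (hi : M 3 0 = i)
    {k : Fin S.n} (hk : M 4 0 = k) (h7 : 0 < M 7 0) {w : Fin S.n → ℤ}
    (hw : w k = (S.rowHom i (S.rowVec M (k + 1))).val) :
    Ok B clearRow M (rowTime S.n B.size) (fun M' =>
      AgreeOff [1, 2, 5, 6, 7, 8, 9, 12] M M' ∧ S.Reduced M' ∧ 0 < M' 7 0 ∧
      S.lattice M' (Function.update w k 0) = S.lattice M w ∧
      ∀ l, l ≠ (k : ℕ) + 1 → S.rowVec M' l = S.rowVec M l) := by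
  have hval : (Expr.add (.var 4) (.const 1)).value M = ((k + 1 : ℕ) : ℤ) := by
    simp [Expr.value, hk]
  refine Ok.store_seq (by decide) (fun _ => ?_) ?_
  · have := hM.n_le
    rw [hval]
    omega
  rw [hval]
  refine Ok.store_seq (by decide) (fun _ => by simp [Expr.value]) ?_
  simp only [Expr.value, Int.toNat_zero]
  set M₁ := (M.write 12 0 ((k + 1 : ℕ) : ℤ)).write 6 0 0 with hM₁
  have hf₁ : AgreeOff [6, 12] M M₁ :=
    ((AgreeOff.refl _ _).write (by decide) _ _).write (by decide) _ _
  have h₁ := hM.congr (hf₁ 0 (by decide))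
  have hk₁ : M₁ 12 0 = ((k + 1 : ℕ) : ℤ) := by
    rw [hM₁, Mem.write_bank_ne _ _ _ (by decide), Mem.write_self]
  have e6 : M₁ 6 0 = 0 := Mem.write_self _ _ _ _
  have hd := S.two_le_d i
  refine Ok.seq ((innerProd_rowHom_ok h₁ i (by rw [hf₁ 3 (by decide), hi]) hk₁
    (by rw [e6]) (by rw [e6]; omega)).mono le_rfl ?_)
  rintro M₂ ⟨hf₂, hv, hv', hval⟩
  have hf₁₂ : AgreeOff [5, 6, 12] M M₂ := hf₁.trans hf₂ (by simp) (by simp)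
  have h₂ := hM.congr (hf₁₂ 0 (by decide))
  have hk₂ : M₂ 12 0 = ((k + 1 : ℕ) : ℤ) := by rw [hf₂ 12 (by decide), hk₁]
  have hwk : M₂ 6 0 = w k := by
    rw [hw, ← rowVec_congr_bank (hf₁ 1 (by decide)) (k + 1)]
    rw [e6, Int.cast_zero, zero_add] at hval
    rw [← hval, ZMod.val_intCast, Int.emod_eq_of_lt hv hv']
  refine (euclidLoop_ok h₂ (hr.congr (hf₁₂ 0 (by decide)) (hf₁₂ 1 (by decide))) hk₂
    (by rwa [hf₁₂ 7 (by decide)]) hv w).mono le_rfl ?_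
  rintro M₃ ⟨hf₃, hr₃, h7₃, hL, hrow⟩
  refine ⟨hf₁₂.trans hf₃ (by simp) (by simp), hr₃, h7₃, ?_, fun l hl => ?_⟩
  · rw [hL, hwk, Function.update_eq_self]
    simp only [lattice, pivVec, rowVec_congr_bank (hf₁₂ 1 (by decide)), hf₁₂ 2 (by decide),
      hf₁₂ 7 (by decide)]
  · rw [hrow l hl, rowVec_congr_bank (hf₁₂ 1 (by decide))]

/-- After the loop all generators have value `0`, and the pivot together with them still generates
the lattice that the generators with their original values generate. -/
theorem clearRows_ok (hM : S.IsInput B M) (hr : S.Reduced M) (i : Fin S.m) (hi : M 3 0 = i)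
    (h7 : 0 < M 7 0) :
    Ok B (.for 4 nE clearRow) M (S.n * (rowTime S.n B.size + 2) + 2) (fun M' =>
      AgreeOff [1, 2, 4, 5, 6, 7, 8, 9, 12] M M' ∧ S.Reduced M' ∧ 0 < M' 7 0 ∧
      S.lattice M' (fun _ => 0) =
        S.lattice M (fun l => (S.rowHom i (S.rowVec M (l + 1))).val) ∧
      S.rowVec M' 0 = S.rowVec M 0) := by
  refine Ok.for (fun k M' =>
      AgreeOff [1, 2, 4, 5, 6, 7, 8, 9, 12] M M' ∧ S.Reduced M' ∧ 0 < M' 7 0 ∧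
      S.lattice M' (fun l => if l < k then 0 else (S.rowHom i (S.rowVec M' (l + 1))).val) =
        S.lattice M (fun l => (S.rowHom i (S.rowVec M (l + 1))).val) ∧
      S.rowVec M' 0 = S.rowVec M 0) S.n (by decide) hM.n_le ?_ ?_ ?_ ?_
  · rintro l M' ⟨hf, -⟩
    exact value_nE (hM.congr (hf 0 (by decide))).toHasInput
  · have hf : AgreeOff [4] M (M.write 4 0 0) := (AgreeOff.refl _ _).write (by decide) _ _
    refine ⟨hf.trans (AgreeOff.refl [] _) (by simp) (by simp),
      hr.congr (hf 0 (by decide)) (hf 1 (by decide)), by rwa [hf 7 (by decide)], ?_, ?_⟩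
    · simp only [not_lt_zero, if_false, lattice, pivVec, rowVec_congr_bank (hf 1 (by decide)),
        hf 2 (by decide), hf 7 (by decide)]
    · rw [rowVec_congr_bank (hf 1 (by decide))]
  · rintro k hk M' ⟨hf, hr', h7', hL, hrow⟩ hk'
    have hM' := hM.congr (hf 0 (by decide))
    refine (clearRow_ok (k := ⟨k, hk⟩) hM' hr' i (by rw [hf 3 (by decide), hi]) hk' h7'
      (w := fun l => if (l : ℕ) < k then 0 else (S.rowHom i (S.rowVec M' (l + 1))).val)
      (by simp)).mono le_rfl ?_
    rintro M'' ⟨hf', hr'', h7'', hL', hrow'⟩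
    have hf'' : AgreeOff [4] M'' (M''.write 4 0 (k + 1)) :=
      (AgreeOff.refl _ _).write (by decide) _ _
    refine ⟨by rw [hf' 4 (by decide), hk'],
      (hf.trans hf' (by simp) (by simp)).write (by decide) _ _,
      hr''.congr (hf'' 0 (by decide)) (hf'' 1 (by decide)), by rwa [hf'' 7 (by decide)], ?_, ?_⟩
    · rw [← hL, ← hL']
      simp only [lattice, pivVec, rowVec_congr_bank (hf'' 1 (by decide)),
        hf'' 2 (by decide), hf'' 7 (by decide)]
      congr 4
      ext1 l
      congr 1
      rcases eq_or_ne l ⟨k, hk⟩ with rfl | hl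
      · simp
      · have hl' : (l : ℕ) ≠ k := fun h => hl (Fin.ext h)
        rw [Function.update_of_ne hl, hrow' (l + 1) (by simpa using hl')]
        simp only [show (l : ℕ) < k + 1 ↔ (l : ℕ) < k by omega]
    · rw [rowVec_congr_bank (hf'' 1 (by decide)), hrow' 0 (by simp), hrow]
  · rintro M' ⟨hf, hr', h7', hL, hrow⟩
    refine ⟨hf, hr', h7', ?_, hrow⟩
    rw [← hL]
    simp

/-- The state after the first `i` equations: the rows `1, …, n` generate the kernel of these
equations, variable `11` is its order, and row `0` is a solution as long as variable `10` is `1`. -/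
structure Invariant (S : LinSystem) (B i : ℕ) (M : Mem) : Prop extends S.IsInput B M where
  reduced : S.Reduced M
  closure_eq : AddSubgroup.closure (Set.range fun l : Fin S.n => S.rowVec M (l + 1)) = S.kerUpTo i
  count_eq : M 11 0 = Nat.card (S.kerUpTo i)
  solution : M 10 0 = 1 ∧ S.rowVec M 0 ∈ S.solUpTo i ∨ M 10 0 = 0 ∧ S.solUpTo i = ∅

theorem Invariant.congr {i : ℕ} (h : S.Invariant B i M) (h0 : M' 0 = M 0) (h1 : M' 1 = M 1)
    (h10 : M' 10 = M 10) (h11 : M' 11 = M 11) : S.Invariant B i M' where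
  toIsInput := h.toIsInput.congr h0
  reduced := h.reduced.congr h0 h1
  closure_eq := by simpa only [rowVec_congr_bank h1] using h.closure_eq
  count_eq := by rw [h11, h.count_eq]
  solution := by rw [h10, rowVec_congr_bank h1]; exact h.solution

/-- Here `v` is the defect of the equation at the old particular solution. -/
theorem correctSolution_ok (hM : S.IsInput B M) (hr : S.Reduced M) (hB : 1 ≤ B) (i : Fin S.m)
    (hi : M 3 0 = i) (h10 : M 10 0 = 0 ∨ M 10 0 = 1) :
    Ok B correctSolution M (S.n * 3 + 2 + (S.n * 3 + 2 + 1 + 1) + 1 + 1) (fun M' =>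
      AgreeOff [1, 5, 6, 8, 10, 12] M M' ∧ S.Reduced M' ∧
      (∀ l ≠ 0, S.rowVec M' l = S.rowVec M l) ∧
      ∃ v : ℤ, (v : ZMod (S.d i)) = S.rowHom i (S.rowVec M 0) - S.b i ∧
        S.rowVec M' 0 = S.rowVec M 0 - (v / M 7 0) • S.pivVec M ∧
        M' 10 0 = M 10 0 * if v % M 7 0 = 0 then 1 else 0) := by
  have hd := S.two_le_d i
  have hdB := hM.d_le i
  refine Ok.store_seq (by decide) (fun _ => by simp [Expr.value]) ?_
  simp only [Expr.value, Int.toNat_zero]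
  set M₀ := M.write 12 0 0 with hM₀
  have hf₀ : AgreeOff [12] M M₀ := (AgreeOff.refl _ _).write (by decide) _ _
  have h₀ := hM.congr (hf₀ 0 (by decide))
  have hi₀ : M₀ 3 0 = i := by rw [hf₀ 3 (by decide), hi]
  have hval : (Expr.mod (.sub (.const 0) bE) dE).value M₀ = (0 - ((S.b i).val : ℤ)) % S.d i := by
    simp only [Expr.value, value_bE h₀.toHasInput hi₀, value_dE hi₀, h₀.d_eq, h₀.b_eq]
  have hpos : (0 : ℤ) < S.d i := by omega
  refine Ok.store_seq (by decide) (fun _ => ?_) ?_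
  · rw [hval]
    exact natAbs_emod_le hpos (by exact_mod_cast hdB)
  rw [hval]
  simp only [Expr.value, Int.toNat_zero]
  set M₁ := M₀.write 6 0 ((0 - ((S.b i).val : ℤ)) % S.d i) with hM₁
  have hf₁ : AgreeOff [6, 12] M M₁ := hf₀.trans
    ((AgreeOff.refl [6] _).write (by decide) _ _) (by simp) (by simp)
  have h₁ := hM.congr (hf₁ 0 (by decide))
  have hk₁ : M₁ 12 0 = ((0 : ℕ) : ℤ) := by
    rw [hM₁, Mem.write_bank_ne _ _ _ (by decide), hM₀, Mem.write_self, Nat.cast_zero]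
  have e6 : M₁ 6 0 = (0 - ((S.b i).val : ℤ)) % S.d i := Mem.write_self _ _ _ _
  refine Ok.seq ((innerProd_rowHom_ok h₁ i (by rw [hf₁ 3 (by decide), hi]) hk₁
    (by rw [e6]; exact Int.emod_nonneg _ hpos.ne')
    (by rw [e6]; exact Int.emod_lt_of_pos _ hpos)).mono le_rfl ?_)
  rintro M₂ ⟨hf₂, -, -, hv⟩
  have hf₁₂ : AgreeOff [5, 6, 12] M M₂ := hf₁.trans hf₂ (by simp) (by simp)
  refine Ok.store_seq (by decide) (fun hb => ?_) ?_
  · exact (Int.natAbs_ediv_le_natAbs _ _).trans (hb _ _)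
  have hdiv : (Expr.div (.var 6) (.var 7)).value M₂ = M₂ 6 0 / M 7 0 := by
    simp [Expr.value, hf₁₂ 7 (by decide)]
  rw [hdiv]
  simp only [Expr.value, Int.toNat_zero]
  set M₃ := M₂.write 8 0 (M₂ 6 0 / M 7 0) with hM₃
  have hf₃ : AgreeOff [8] M₂ M₃ := (AgreeOff.refl _ _).write (by decide) _ _
  have hf₁₃ : AgreeOff [5, 6, 8, 12] M M₃ := hf₁₂.trans hf₃ (by simp) (by simp)
  have h₃ := hM.congr (hf₁₃ 0 (by decide))
  have hk₃ : M₃ 12 0 = ((0 : ℕ) : ℤ) := by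
    rw [hf₃ 12 (by decide), hf₂ 12 (by decide), hk₁]
  have e8 : M₃ 8 0 = M₂ 6 0 / M 7 0 := Mem.write_self _ _ _ _
  refine Ok.seq (T := S.n * 3 + 2) (T' := 1) ((subPivot_ok h₃.toHasInput hk₃).mono le_rfl ?_)
  rintro M₄ ⟨hf₄, hrow, hfr⟩
  have hf₁₄ : AgreeOff [1, 5, 6, 8, 12] M M₄ := hf₁₃.trans hf₄ (by simp) (by simp)
  have e64 : M₄ 6 0 = M₂ 6 0 := by rw [hf₄ 6 (by decide), hf₃ 6 (by decide)]
  have hflag : (Expr.mul (.var 10) (.eq (.mod (.var 6) (.var 7)) (.const 0))).value M₄ =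
      M 10 0 * if M₂ 6 0 % M 7 0 = 0 then 1 else 0 := by
    simp only [Expr.value, Int.toNat_zero, e64, hf₁₄ 7 (by decide), hf₁₄ 10 (by decide)]
  refine Ok.store (by decide) (fun _ => ?_) ?_
  · rw [hflag]
    rcases h10 with h | h <;> rw [h] <;> split_ifs <;> simp [hB]
  rw [hflag]
  simp only [Expr.value, Int.toNat_zero]
  have hr₃ : S.Reduced M₃ := hr.congr (hf₁₃ 0 (by decide)) (hf₁₃ 1 (by decide))
  have hr₄ : S.Reduced M₄ := Reduced.of_frame h₃ hr₃ (hf₄ 0 (by decide)) hrow hfr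
  set M₅ := M₄.write 10 0 (M 10 0 * if M₂ 6 0 % M 7 0 = 0 then 1 else 0) with hM₅
  have hf₅ : AgreeOff [10] M₄ M₅ := (AgreeOff.refl _ _).write (by decide) _ _
  refine ⟨hf₁₄.trans hf₅ (by simp) (by simp), hr₄.congr (hf₅ 0 (by decide)) (hf₅ 1 (by decide)),
    fun l hl => ?_, M₂ 6 0, ?_, ?_, Mem.write_self _ _ _ _⟩
  · rw [rowVec_congr_bank (hf₅ 1 (by decide)), rowVec_of_frame hl hfr,
      rowVec_congr_bank (hf₁₃ 1 (by decide))]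
  · rw [hv, e6, rowVec_congr_bank (hf₁ 1 (by decide))]
    simp [sub_eq_add_neg, add_comm]
  · rw [rowVec_congr_bank (hf₅ 1 (by decide)), rowVec, vec_emod h₃ hrow]
    ext j
    simp [pivVec, rowVec, vec, e8, hf₁₃ 1 (by decide), hf₁₃ 2 (by decide)]

/-- A bound for the time of `equation`, in units, when the cells have at most `s` bits. -/
def eqTime (n s : ℕ) : ℕ :=
  (n * 3 + 3) + ((n * (rowTime n s + 2) + 2) +
    ((n * 3 + 2 + (n * 3 + 2 + 1 + 1) + 1 + 1) + 1))

/-- The particular solution can be corrected exactly when the value `g` of the pivot divides the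
defect `v` of the equation. -/
theorem solution_step {i : Fin S.m} {x₀ x₀' p : S.H} {g v f f' : ℤ}
    (hp : p ∈ S.kerUpTo i) (hpg : S.rowHom i p = g)
    (hdvd : ∀ y ∈ S.kerUpTo i, ∀ z : ℤ, S.rowHom i y = z → g ∣ z)
    (hv : (v : ZMod (S.d i)) = S.rowHom i x₀ - S.b i) (hx : x₀' = x₀ - (v / g) • p)
    (hf : f' = f * if v % g = 0 then 1 else 0)
    (h : f = 1 ∧ x₀ ∈ S.solUpTo i ∨ f = 0 ∧ S.solUpTo i = ∅) :
    f' = 1 ∧ x₀' ∈ S.solUpTo (i + 1) ∨ f' = 0 ∧ S.solUpTo (i + 1) = ∅ := by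
  rcases h with ⟨rfl, h⟩ | ⟨rfl, h⟩
  · by_cases hg : v % g = 0
    · refine Or.inl ⟨by rw [hf, if_pos hg, one_mul], mem_solUpTo_succ.mpr ⟨?_, ?_⟩⟩
      · rw [hx]
        exact sub_mem_solUpTo h (zsmul_mem hp _)
      · have h1 : v / g * g = v := Int.ediv_mul_cancel (Int.dvd_of_emod_eq_zero hg)
        have h2 : ((v / g : ℤ) : ZMod (S.d i)) * (g : ZMod (S.d i)) = v := by
          rw [← Int.cast_mul, h1]
        rw [hx, map_sub, map_zsmul, hpg, zsmul_eq_mul, h2, hv]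
        abel
    · refine Or.inr ⟨by rw [hf, if_neg hg, mul_zero], Set.eq_empty_iff_forall_notMem.mpr ?_⟩
      intro y hy
      obtain ⟨hy1, hy2⟩ := mem_solUpTo_succ.mp hy
      refine hg (Int.emod_eq_zero_of_dvd (hdvd (x₀ - y) (sub_mem_kerUpTo h hy1) v ?_))
      rw [map_sub, hy2, hv]
  · refine Or.inr ⟨by rw [hf, zero_mul], Set.eq_empty_iff_forall_notMem.mpr fun y hy => ?_⟩
    have := (mem_solUpTo_succ.mp hy).1
    rw [h] at this
    exact this

/-- At the start of an equation the lattice is the lifted graph of its left-hand side on the current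
kernel; at the end the generators of value `0` in it generate the next kernel. -/
theorem equation_ok {i : Fin S.m} (hM : S.Invariant B i M) (hB : 1 ≤ B)
    (hcard : Nat.card S.H ≤ B) (hi : M 3 0 = i) :
    Ok B equation M (eqTime S.n B.size) (fun M' =>
      AgreeOff [1, 2, 4, 5, 6, 7, 8, 9, 10, 11, 12] M M' ∧ S.Invariant B (i + 1) M') := by
  have hd2 := S.two_le_d i
  refine Ok.seq ((initPivot_ok hM.toHasInput hi).mono le_rfl ?_)
  rintro M₁ ⟨hf₁, h7, hpiv⟩
  rw [hM.d_eq i] at h7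
  have h₁ := hM.toIsInput.congr (hf₁ 0 (by decide))
  have hr₁ := hM.reduced.congr (hf₁ 0 (by decide)) (hf₁ 1 (by decide))
  refine Ok.seq ((clearRows_ok h₁ hr₁ i (by rw [hf₁ 3 (by decide), hi])
    (by rw [h7]; omega)).mono le_rfl ?_)
  rintro M₂ ⟨hf₂, hr₂, h7₂, hL, hrow₂⟩
  have hL₁ : S.lattice M₁ (fun l => (S.rowHom i (S.rowVec M₁ (l + 1))).val) =
      graphLift (S.kerUpTo i) (S.rowHom i) := by
    have hp0 : S.pivVec M₁ = 0 := by
      ext j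
      simp [pivVec, vec, hpiv j j.2]
    rw [lattice, hp0, h7, closure_eq_graphLift, ← hM.closure_eq]
    simp only [rowVec_congr_bank (hf₁ 1 (by decide))]
  rw [hL₁] at hL
  have hf₁₂ : AgreeOff [1, 2, 4, 5, 6, 7, 8, 9, 12] M M₂ := hf₁.trans hf₂ (by simp) (by simp)
  have h₂ := hM.toIsInput.congr (hf₁₂ 0 (by decide))
  have h10 : M₂ 10 0 = 0 ∨ M₂ 10 0 = 1 := by
    rw [hf₁₂ 10 (by decide)]
    exact hM.solution.elim (fun h => Or.inr h.1) fun h => Or.inl h.1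
  refine Ok.seq ((correctSolution_ok h₂ hr₂ hB i (by rw [hf₁₂ 3 (by decide), hi]) h10).mono
    le_rfl ?_)
  rintro M₃ ⟨hf₃, hr₃, hrow₃, v, hv, hx, hflag⟩
  have hf₁₃ : AgreeOff [1, 2, 4, 5, 6, 7, 8, 9, 10, 12] M M₃ := hf₁₂.trans hf₃ (by simp) (by simp)
  have h₃ := hM.toIsInput.congr (hf₁₃ 0 (by decide))
  have hi₃ : M₃ 3 0 = i := by rw [hf₁₃ 3 (by decide), hi]
  have hcount : (Expr.div (.mul (.var 11) (.var 7)) dE).value M₃ =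
      Nat.card (S.kerUpTo (i + 1)) := by
    simp only [Expr.value, Int.toNat_zero, value_dE hi₃, h₃.d_eq, hf₁₃ 11 (by decide),
      hf₃ 7 (by decide), hM.count_eq]
    rw [card_mul_pivot_eq hL h7₂, ← kerUpTo_succ, Int.mul_ediv_cancel _ (by omega)]
  refine Ok.store (by decide) (fun _ => ?_) ?_
  · rw [hcount, Int.natAbs_natCast]
    exact (Nat.card_le_card_of_injective _ Subtype.val_injective).trans hcard
  rw [hcount]
  simp only [Expr.value, Int.toNat_zero]
  set M₄ := M₃.write 11 0 (Nat.card (S.kerUpTo (i + 1))) with hM₄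
  have hf₄ : AgreeOff [11] M₃ M₄ := (AgreeOff.refl _ _).write (by decide) _ _
  refine ⟨hf₁₃.trans hf₄ (by simp) (by simp), ⟨h₃.congr (hf₄ 0 (by decide)),
    hr₃.congr (hf₄ 0 (by decide)) (hf₄ 1 (by decide)), ?_, Mem.write_self _ _ _ _, ?_⟩⟩
  · rw [kerUpTo_succ, ← closure_range_eq_inf_ker hL h7₂.ne']
    simp only [rowVec_congr_bank (hf₄ 1 (by decide)), hrow₃ _ (Nat.succ_ne_zero _)]
  · obtain ⟨hp, hpg⟩ := pivot_mem hL
    rw [hf₄ 10 (by decide), rowVec_congr_bank (hf₄ 1 (by decide))]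
    refine solution_step hp hpg (fun y hy z hz => pivot_dvd hL hy hz) hv hx hflag ?_
    rw [hrow₂, rowVec_congr_bank (hf₁ 1 (by decide)), hf₁₂ 10 (by decide)]
    exact hM.solution

theorem card_H (S : LinSystem) : Nat.card S.H = ∏ j, S.c j := by
  simp [H]

theorem card_G (S : LinSystem) : Nat.card S.G = ∏ i, S.d i := by
  simp [G]

theorem initRows_invariant_ok (hM : S.IsInput B M) (hB : 1 ≤ B) (hcard : Nat.card S.H ≤ B)
    (h1 : M 1 = 0) :
    Ok B initRows M (S.n * 4 + 4) (fun M' => S.Invariant B 0 M') := by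
  have hprod : ∏ j ∈ Finset.range S.n, M 0 (2 + S.m + j) = Nat.card S.H := by
    rw [← Fin.prod_univ_eq_prod_range (fun j => M 0 (2 + S.m + j)), card_H]
    simp [hM.c_eq]
  refine (initRows_ok hM.toHasInput hB h1 fun l hl => ?_).mono le_rfl ?_
  · calc ∏ j ∈ Finset.range l, M 0 (2 + S.m + j)
        ≤ ∏ j ∈ Finset.range S.n, M 0 (2 + S.m + j) := by
          rw [← Finset.prod_range_mul_prod_Ico _ hl]
          refine le_mul_of_one_le_right (Finset.prod_nonneg fun j hj => ?_) ?_
          · exact (hM.c_pos j (by simp at hj; omega)).le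
          · rw [← Finset.prod_const_one (s := Finset.Ico l S.n)]
            exact Finset.prod_le_prod (fun _ _ => zero_le_one) fun j hj =>
              hM.c_pos j (Finset.mem_Ico.mp hj).2
      _ ≤ B := by rw [hprod]; exact_mod_cast hcard
  · rintro M' ⟨hf, h10, h11, hzero, hunit⟩
    have hM' := hM.congr (hf 0 (by decide))
    refine ⟨hM', ?_, ?_, ?_, ?_⟩
    · intro k hk j hj
      have hc : 2 ≤ M' 0 (2 + S.m + j) := by
        rw [hM'.c_eq ⟨j, hj⟩]
        exact_mod_cast S.two_le_c ⟨j, hj⟩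
      rcases Nat.eq_zero_or_pos k with rfl | hk0
      · have := hzero j hj
        rw [zero_mul, add_zero, add_comm 1 j, this]
        omega
      · obtain ⟨k, rfl⟩ := Nat.exists_eq_add_of_le' hk0
        rw [hunit k hk j hj]
        split_ifs <;> omega
    · have hrow : ∀ l : Fin S.n, S.rowVec M' (l + 1) = Pi.single l 1 := by
        intro l
        ext j
        rw [rowVec, vec, hunit l l.2 j j.2]
        rcases eq_or_ne j l with rfl | hjl
        · simp
        · simp [hjl, Fin.val_ne_of_ne hjl]
      simp only [hrow]
      rw [kerUpTo_zero, eq_top_iff]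
      intro x _
      rw [AddSubgroup.mem_closure_range_iff_of_fintype]
      refine ⟨fun j => (x j).val, ?_⟩
      ext j
      rw [Finset.sum_apply, Finset.sum_eq_single j]
      · simp
      · intro l _ hl
        simp [hl.symm]
      · simp
    · rw [h11, hprod, kerUpTo_zero, Nat.card_congr AddSubgroup.topEquiv.toEquiv]
    · refine Or.inl ⟨h10, ?_⟩
      rw [solUpTo_zero]
      trivial

/-- A bound for the time of `solve`, in units, when the cells have at most `s` bits. -/
def solveTime (m n s : ℕ) : ℕ := (n * 4 + 4) + (m * (eqTime n s + 2) + 2)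

theorem solve_ok (hM : S.IsInput B M) (hB : 1 ≤ B) (hmB : S.m ≤ B) (hcard : Nat.card S.H ≤ B)
    (h1 : M 1 = 0) :
    Ok B solve M (solveTime S.m S.n B.size) (fun M' => S.Invariant B S.m M') := by
  refine Ok.seq ((initRows_invariant_ok hM hB hcard h1).mono le_rfl fun M₁ h₁ => ?_)
  refine Ok.for (fun i M' => S.Invariant B i M') S.m (by decide) hmB ?_ ?_ ?_ fun _ h => h
  · intro i M' h
    exact value_mE h.toHasInput
  · exact h₁.congr (Mem.write_bank_ne _ _ _ (by decide)) (Mem.write_bank_ne _ _ _ (by decide))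
      (Mem.write_bank_ne _ _ _ (by decide)) (Mem.write_bank_ne _ _ _ (by decide))
  · intro i hi M' h h3
    refine (equation_ok (i := ⟨i, hi⟩) h hB hcard h3).mono le_rfl ?_
    rintro M'' ⟨hf, h'⟩
    exact ⟨by rw [hf 3 (by decide), h3],
      h'.congr (Mem.write_bank_ne _ _ _ (by decide)) (Mem.write_bank_ne _ _ _ (by decide))
        (Mem.write_bank_ne _ _ _ (by decide)) (Mem.write_bank_ne _ _ _ (by decide))⟩

end LinSystem

namespace LinSystem

open RAM

/-! ### Reading the input -/

/-- How a block of the input is read off. -/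
theorem getD_append_ofFn_append {r a : ℕ} (l₁ l₂ : List ℤ) (f : Fin r → ℤ) (i : Fin r)
    (ha : a = l₁.length + i) : (l₁ ++ (List.ofFn f ++ l₂)).getD a 0 = f i := by
  subst ha
  rw [List.getD_append_right _ _ _ _ (by omega), Nat.add_sub_cancel_left,
    List.getD_append _ _ _ _ (by simp), List.getD_eq_getElem _ _ (by simp), List.getElem_ofFn]

variable (S : LinSystem)

/-- The bound `|H| * |G|` for all cells during the run. -/
noncomputable def cellBound : ℕ := Nat.card S.H * Nat.card S.G

theorem two_pow_le_card_H : 2 ^ S.n ≤ Nat.card S.H := by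
  rw [card_H, ← Fin.prod_const]
  exact Finset.prod_le_prod' fun j _ => S.two_le_c j

theorem two_pow_le_card_G : 2 ^ S.m ≤ Nat.card S.G := by
  rw [card_G, ← Fin.prod_const]
  exact Finset.prod_le_prod' fun i _ => S.two_le_d i

theorem card_H_le_cellBound : Nat.card S.H ≤ S.cellBound := Nat.le_mul_of_pos_right _ Nat.card_pos

theorem card_G_le_cellBound : Nat.card S.G ≤ S.cellBound := Nat.le_mul_of_pos_left _ Nat.card_pos

theorem n_lt_cellBound : S.n < S.cellBound :=
  (Nat.lt_two_pow_self.trans_le S.two_pow_le_card_H).trans_le S.card_H_le_cellBound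

theorem m_lt_cellBound : S.m < S.cellBound :=
  (Nat.lt_two_pow_self.trans_le S.two_pow_le_card_G).trans_le S.card_G_le_cellBound

theorem c_le_cellBound (j : Fin S.n) : S.c j ≤ S.cellBound := by
  refine le_trans ?_ S.card_H_le_cellBound
  rw [card_H]
  exact Nat.le_of_dvd (Finset.prod_pos fun j _ => Nat.pos_of_ne_zero (NeZero.ne _))
    (Finset.dvd_prod_of_mem _ (Finset.mem_univ j))

theorem d_le_cellBound (i : Fin S.m) : S.d i ≤ S.cellBound := by
  refine le_trans ?_ S.card_G_le_cellBound
  rw [card_G]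
  exact Nat.le_of_dvd (Finset.prod_pos fun j _ => Nat.pos_of_ne_zero (NeZero.ne _))
    (Finset.dvd_prod_of_mem _ (Finset.mem_univ i))

theorem isInput_inputMem : S.IsInput S.cellBound (inputMem S.encode) := by
  have hc : ∀ j : Fin S.n, inputMem S.encode 0 (2 + S.m + j) = S.c j := fun j => by
    have e : S.encode = ([(S.m : ℤ), (S.n : ℤ)] ++ List.ofFn (fun i => (S.d i : ℤ))) ++
        (List.ofFn (fun j => (S.c j : ℤ)) ++
          (List.ofFn (fun k : Fin (S.m * S.n) => S.A k.divNat k.modNat) ++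
            List.ofFn (fun i => ((S.b i).val : ℤ)))) := by
      simp only [encode, List.append_assoc]
    rw [inputMem, if_pos rfl, e]
    exact getD_append_ofFn_append _ _ _ j (by simp; omega)
  constructor
  · constructor
    · simp [inputMem, encode]
    · simp [inputMem, encode]
    · intro j hj
      rw [hc ⟨j, hj⟩]
      exact_mod_cast Nat.pos_of_ne_zero (NeZero.ne _)
    · intro j hj
      rw [hc ⟨j, hj⟩]
      exact_mod_cast S.c_le_cellBound _
    · exact S.n_lt_cellBound.le
  · intro i
    have e : S.encode = [(S.m : ℤ), (S.n : ℤ)] ++ (List.ofFn (fun i => (S.d i : ℤ)) ++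
        (List.ofFn (fun j => (S.c j : ℤ)) ++
          (List.ofFn (fun k : Fin (S.m * S.n) => S.A k.divNat k.modNat) ++
            List.ofFn (fun i => ((S.b i).val : ℤ))))) := by
      simp only [encode, List.append_assoc]
    rw [inputMem, if_pos rfl, e]
    exact getD_append_ofFn_append _ _ _ i (by simp)
  · exact S.d_le_cellBound
  · exact hc
  · intro i j
    have hk : ((finProdFinEquiv (i, j)).divNat, (finProdFinEquiv (i, j)).modNat) = (i, j) :=
      finProdFinEquiv.symm_apply_apply (i, j)
    have e : S.encode = ([(S.m : ℤ), (S.n : ℤ)] ++ List.ofFn (fun i => (S.d i : ℤ)) ++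
        List.ofFn (fun j => (S.c j : ℤ))) ++
          (List.ofFn (fun k : Fin (S.m * S.n) => S.A k.divNat k.modNat) ++
            List.ofFn (fun i => ((S.b i).val : ℤ))) := by
      simp only [encode, List.append_assoc]
    rw [inputMem, if_pos rfl, e]
    refine (getD_append_ofFn_append _ _ _ (finProdFinEquiv (i, j)) ?_).trans ?_
    · simp [finProdFinEquiv, mul_comm]
      omega
    · rw [Prod.mk.injEq] at hk
      simp only [hk]
  · intro i
    rw [inputMem, if_pos rfl, encode, ← List.append_nil (List.ofFn fun i => ((S.b i).val : ℤ))]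
    exact getD_append_ofFn_append _ _ _ i (by simp; omega)

theorem bdd_inputMem : Bdd S.cellBound (inputMem S.encode) := by
  have hlt : ∀ {x y : ℤ} {B : ℕ}, 0 ≤ x → x < y → y ≤ B → x.natAbs ≤ B := by omega
  intro k a
  unfold inputMem
  split_ifs with hk
  · rcases lt_or_ge a S.encode.length with ha | ha
    · rw [List.getD_eq_getElem _ _ ha]
      have hmem := List.getElem_mem ha
      generalize S.encode[a] = z at hmem ⊢
      simp only [encode, List.mem_append, List.mem_ofFn, List.mem_cons, List.not_mem_nil,
        or_false] at hmem
      rcases hmem with ((((h | h) | ⟨i, h⟩) | ⟨j, h⟩) | ⟨k, h⟩) | ⟨i, h⟩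
      · rw [h]; exact S.m_lt_cellBound.le
      · rw [h]; exact S.n_lt_cellBound.le
      · rw [← h]; exact S.d_le_cellBound i
      · rw [← h]; exact S.c_le_cellBound j
      · rw [← h]
        exact hlt (S.col_mem _ _).1 (S.col_mem _ _).2 (by exact_mod_cast S.d_le_cellBound _)
      · rw [← h]
        exact (ZMod.val_lt _).le.trans (S.d_le_cellBound i)
    · rw [List.getD_eq_default _ _ ha]
      simp
  · simp

/-! ### The running time -/

theorem rowTime_le {n s L : ℕ} (hL : 1 ≤ L) (hn : n ≤ L) (hs : s ≤ 2 * L) :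
    rowTime n s ≤ 70 * L ^ 2 := by
  have h : rowTime n s ≤ (L * 3 + 2 * L + ((2 * (2 * L) + L) * (L * 5 + 7 * L) + L)) + L + L := by
    unfold rowTime
    gcongr <;> omega
  nlinarith

theorem eqTime_le {n s L : ℕ} (hL : 1 ≤ L) (hn : n ≤ L) (hs : s ≤ 2 * L) :
    eqTime n s ≤ 100 * L ^ 3 := by
  have h₁ : n * (rowTime n s + 2) ≤ L * (70 * L ^ 2 + 2) := by
    have := rowTime_le hL hn hs
    gcongr
  have h₂ : L ≤ L ^ 3 := Nat.le_self_pow (by norm_num) L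
  unfold eqTime
  nlinarith

theorem solveTime_le {m n s L : ℕ} (hL : 1 ≤ L) (hm : m ≤ L) (hn : n ≤ L) (hs : s ≤ 2 * L) :
    solveTime m n s + 1 ≤ 120 * L ^ 4 := by
  have h₁ : m * (eqTime n s + 2) ≤ L * (100 * L ^ 3 + 2) := by
    have := eqTime_le hL hn hs
    gcongr
  have h₂ : L ≤ L ^ 4 := Nat.le_self_pow (by norm_num) L
  unfold solveTime
  nlinarith

theorem n_le_log : S.n ≤ Nat.log 2 (Nat.card S.H) :=
  Nat.le_log_of_pow_le (by norm_num) S.two_pow_le_card_H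

theorem m_le_log : S.m ≤ Nat.log 2 (Nat.card S.G) :=
  Nat.le_log_of_pow_le (by norm_num) S.two_pow_le_card_G

theorem size_cellBound_le :
    S.cellBound.size ≤ Nat.log 2 (Nat.card S.H) + Nat.log 2 (Nat.card S.G) + 2 := by
  rw [Nat.size_le, cellBound]
  calc _ < 2 ^ (Nat.log 2 (Nat.card S.H)).succ * 2 ^ (Nat.log 2 (Nat.card S.G)).succ :=
        Nat.mul_lt_mul'' (Nat.lt_pow_succ_log_self (by norm_num) _)
          (Nat.lt_pow_succ_log_self (by norm_num) _)
    _ = _ := by rw [← pow_add]; congr 1; omega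

/-- Solving the system and writing the value of `e` into the first output cell takes
polylogarithmic time. -/
theorem solvableInPolylogTime_of_expr {R : LinSystem → List ℤ → Prop} (e : Expr)
    (hw : e.weight < 50)
    (h : ∀ (S : LinSystem) (M : Mem), S.Invariant S.cellBound S.m M →
      (e.value M).natAbs ≤ S.cellBound ∧ ∃ w, HasOutput (M.write 1 0 (e.value M)) w ∧ R S w) :
    SolvableInPolylogTime R := by
  refine ⟨.seq solve (.store 1 (.const 0) e), 120 * 180 ^ 2, 6, fun S => ?_⟩
  have hok : Ok S.cellBound (.seq solve (.store 1 (.const 0) e)) (inputMem S.encode)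
      (solveTime S.m S.n S.cellBound.size + 1) (fun M => ∃ w, HasOutput M w ∧ R S w) := by
    refine Ok.seq ((solve_ok S.isInput_inputMem (Nat.one_le_of_lt S.n_lt_cellBound)
      S.m_lt_cellBound.le S.card_H_le_cellBound (by ext; simp [inputMem])).mono le_rfl
      fun M hM => ?_)
    exact Ok.store (by simp [Expr.weight, size]; omega) (fun _ => (h S M hM).1) (h S M hM).2
  obtain ⟨M, t, hrun, ht, -, w, hout, hR⟩ := hok S.bdd_inputMem
  refine ⟨M, t, w, hrun, ht.trans ?_, hout, hR⟩
  set L := Nat.log 2 (Nat.card S.H) + Nat.log 2 (Nat.card S.G) + 1 with hL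
  have hL1 : 1 ≤ L := by omega
  have h₁ := S.n_le_log
  have h₂ := S.m_le_log
  have h₃ := S.size_cellBound_le
  -- All of `m`, `n` and the cell size are `O(L)`: this gives `O(L ^ 4)` units, each costing
  -- `O(L ^ 2)`.
  calc _ ≤ 120 * L ^ 4 * (60 * (3 * L)) ^ 2 := by
        unfold unitCost
        have := solveTime_le hL1 (show S.m ≤ L by omega) (show S.n ≤ L by omega)
          (show S.cellBound.size ≤ 2 * L by omega)
        gcongr
        omega
    _ = 120 * 180 ^ 2 * L ^ 6 := by ring

/-! ### Reading off the answers -/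

variable {S} {M : Mem}

theorem Invariant.flag {B : ℕ} (h : S.Invariant B S.m M) :
    M 10 0 = 1 ∧ S.rowVec M 0 ∈ S.solutions ∨ M 10 0 = 0 ∧ S.solutions = ∅ := by
  rw [← solUpTo_eq]
  exact h.solution

theorem val_rowVec {B : ℕ} (h : S.IsInput B M) (hr : S.Reduced M) {k : ℕ} (hk : k ≤ S.n)
    (j : Fin S.n) : ((S.rowVec M k j).val : ℤ) = M 1 (1 + k * S.n + j) := by
  obtain ⟨h₁, h₂⟩ := hr k hk j j.2
  rw [rowVec, vec, ZMod.val_intCast, Int.emod_eq_of_lt h₁ (by rwa [← h.c_eq])]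

/-- The rows are stored in bank `1` exactly as the encoding of a tuple requires. -/
theorem encodeTuple_rowVec {B : ℕ} (h : S.IsInput B M) (hr : S.Reduced M) :
    S.encodeTuple (List.ofFn fun k : Fin (S.n + 1) => S.rowVec M k) =
      ((S.n + 1 : ℕ) : ℤ) :: List.ofFn fun a : Fin ((S.n + 1) * S.n) => M 1 (1 + a) := by
  rw [encodeTuple, List.length_ofFn, List.ofFn_mul, List.flatMap, List.map_ofFn]
  congr 3
  ext1 k
  simp only [Function.comp_apply]
  congr 1
  ext1 j
  rw [val_rowVec h hr (Nat.lt_succ_iff.mp k.2), add_assoc]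

end LinSystem

/-! ### The three problems -/

open LinSystem RAM in
theorem solvableInPolylogTime_decide : SolvableInPolylogTime (fun S w =>
    (S.solutions.Nonempty ∧ w = [1]) ∨ (¬ S.solutions.Nonempty ∧ w = [0])) := by
  refine solvableInPolylogTime_of_expr (.var 10) (by decide) fun S M h => ?_
  have hpos : 1 ≤ S.cellBound := Nat.one_le_of_lt S.n_lt_cellBound
  have hval : (Expr.var 10).value M = M 10 0 := by simp [Expr.value]
  rw [hval]
  refine ⟨?_, [M 10 0], ?_, ?_⟩
  · rcases h.flag with ⟨h, -⟩ | ⟨h, -⟩ <;> simp [h, hpos]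
  · intro a ha
    obtain rfl : a = 0 := by simpa using ha
    exact Mem.write_self _ _ _ _
  · rcases h.flag with ⟨h, h'⟩ | ⟨h, h'⟩
    · exact Or.inl ⟨⟨_, h'⟩, by rw [h]⟩
    · exact Or.inr ⟨by simp [h'], by rw [h]⟩

open LinSystem RAM in
theorem solvableInPolylogTime_count :
    SolvableInPolylogTime (fun S w => w = [(Nat.card S.solutions : ℤ)]) := by
  refine solvableInPolylogTime_of_expr (.mul (.var 10) (.var 11)) (by decide) fun S M h => ?_
  have hval : (Expr.mul (.var 10) (.var 11)).value M = Nat.card S.solutions := by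
    simp only [Expr.value, Int.toNat_zero, h.count_eq]
    rcases h.flag with ⟨h, h'⟩ | ⟨h, h'⟩
    · rw [h, one_mul, card_solutions h']
    · simp [h, h']
  rw [hval]
  refine ⟨?_, _, ?_, rfl⟩
  · exact (Nat.card_le_card_of_injective _ Subtype.val_injective).trans S.card_H_le_cellBound
  · intro a ha
    obtain rfl : a = 0 := by simpa using ha
    exact Mem.write_self _ _ _ _

open LinSystem RAM in
/-- When the system is solvable the tuple has exactly `n + 1` elements, and `2 ^ n ≤ |H|`. -/
theorem solvableInPolylogTime_generalSolution : SolvableInPolylogTime (fun S w =>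
    ∃ xs : List S.H, w = S.encodeTuple xs ∧ S.IsGeneralSolution xs ∧
      xs.length ≤ 1 * (Nat.log 2 (Nat.card S.H) + 1) ^ 1) := by
  refine solvableInPolylogTime_of_expr (.mul (.var 10) (.add nE (.const 1))) (by decide)
    fun S M h => ?_
  have hval : (Expr.mul (.var 10) (.add nE (.const 1))).value M =
      M 10 0 * ((S.n + 1 : ℕ) : ℤ) := by
    simp [Expr.value, value_nE h.toHasInput]
  have hn := S.n_lt_cellBound
  rw [hval]
  rcases h.flag with ⟨h10, hsol⟩ | ⟨h10, hsol⟩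
  · rw [h10, one_mul]
    refine ⟨by omega, _, ?_, List.ofFn fun k : Fin (S.n + 1) => S.rowVec M k, rfl, ?_, ?_⟩
    · rw [encodeTuple_rowVec h.toIsInput h.reduced]
      intro a ha
      rcases a with _ | a
      · exact Mem.write_self _ _ _ _
      · rw [Mem.write_addr_ne _ _ _ (Nat.succ_ne_zero a), List.getElem_cons_succ,
          List.getElem_ofFn, add_comm]
    · rw [List.ofFn_succ]
      exact isGeneralSolution_cons hsol h.closure_eq
    · simpa using S.n_le_log
  · rw [h10, zero_mul]
    refine ⟨by simp, _, ?_, [], rfl, hsol, by simp⟩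
    intro a ha
    obtain rfl : a = 0 := by simpa [encodeTuple] using ha
    exact Mem.write_self _ _ _ _

theorem mainTheorem2 :
    -- decide whether the system admits a solution
    SolvableInPolylogTime (fun S w =>
      (S.solutions.Nonempty ∧ w = [1]) ∨ (¬ S.solutions.Nonempty ∧ w = [0])) ∧
    -- count the solutions
    SolvableInPolylogTime (fun S w => w = [(Nat.card S.solutions : ℤ)]) ∧
    -- find a general solution, whose length is polylogarithmic in `|H|`
    (∃ C k : ℕ, SolvableInPolylogTime (fun S w =>
      ∃ xs : List S.H, w = S.encodeTuple xs ∧ S.IsGeneralSolution xs ∧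
        xs.length ≤ C * (Nat.log 2 (Nat.card S.H) + 1) ^ k)) :=
  ⟨solvableInPolylogTime_decide, solvableInPolylogTime_count, 1, 1,
    solvableInPolylogTime_generalSolution⟩
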